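/- An instance of the problem GC (Group Constraint) consists of a finite set $A=\{0,\dots,n-1\}$, permutations $g_1,\dots,g_m$ of $A$, and a constraint $\varphi$ which is a conjunction of atomic constraints $x^{\sigma}\in X$ with $x\in A$, $X\subseteq A$. Write $G=\langle g_1,\dots,g_m\rangle$, $a^g$ for the image of $a$ by $g$, and $a^G$ for the $G$-orbit of $a$. A solution is a permutation $g\in G$ with $x^g\in X$ for every conjunct $x^\sigma\in X$ of $\varphi$. The decision problem asks whether a solution exists; the search problem asks to compute a solution if one exists (and to report that there is none otherwise). The normal form of the constraint is the map $\mathcal C:A\to 2^A$ for which $\mathcal C(a)$ is the set of all $b\in a^G$ such that $b\in X$ for every conjunct $a^\sigma\in X$ of $\varphi$; the constraint is a $k$-constraint if $|\mathcal C(a)|\le k$ for all $a\in A$. For a prime $p$, GC restricted to $p$ and $k$ is GC on those instances for which $G$ is an elementary Abelian $p$-group (it is Abelian and its non-trivial elements have order $p$) and the constraint is a $k$-constraint. For such an instance and a $G$-orbit $O$, let $G|_O$ be the group of the restrictions to $O$ of the elements of $G$, extended to $A$ by the identity outside $O$; let $F$ be the group generated by all the $G|_O$, which is an $\mathbb F_p$-vector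 space (written additively); and let $V_O=\{u\in G|_O : a^u\in\mathcal C(a)\text{ for all }a\in O\}$. The constraint is linear if $\sum_O V_O$ (the sum over all $G$-orbits $O$) is either empty or a linear variety $v+H$ of $F$, where $v\in F$ and $H$ is a subspace of $F$. **Corollary.** GC restricted to $p=k=2$ is solvable in polynomial time, both in its decision version and in its search version: each is computed by a deterministic Turing machine in time polynomial in the length of the input, in which all numbers ($n$, $m$, the number of conjuncts, and the points of $A$) are written in unary, each permutation is given by its table of images, and each atomic constraint $x^\sigma\in X$ by $x$ and the indicator function of $X$. Moreover, in every instance of GC restricted to $p=k=2$ the constraint is linear. -/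

import Mathlib

namespace GroupConstraint

open Equiv

/-- An instance of the problem GC: a finite set `A` of cardinality `n` (taken to be `Fin n`),
permutations `g₁, …, gₘ` of `A`, and a conjunction of atomic constraints `x ^ σ ∈ X`
with `x ∈ A` and `X ⊆ A`, given as the list of the pairs `(x, X)`. -/
structure Instance where
  n : ℕ
  gens : List (Perm (Fin n))
  constraint : List (Fin n × Finset (Fin n))

namespace Instance

/-- The group `G` generated by the given permutations. -/
def group (I : Instance) : Subgroup (Perm (Fin I.n)) :=
  Subgroup.closure {g | g ∈ I.gens}

/-- `g` is a solution of `I`: it lies in `G` and satisfies every conjunct. -/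
def IsSolution (I : Instance) (g : Perm (Fin I.n)) : Prop :=
  g ∈ I.group ∧ ∀ c ∈ I.constraint, g c.1 ∈ c.2

/-- The normal form `𝒞 : A → 2 ^ A` of the constraint: `𝒞 a` is the part of the orbit of `a`
that is allowed by all the conjuncts on `a`. -/
def normalForm (I : Instance) (a : Fin I.n) : Set (Fin I.n) :=
  {b | b ∈ MulAction.orbit I.group a ∧ ∀ c ∈ I.constraint, c.1 = a → b ∈ c.2}

/-- The constraint of `I` is a `k`-constraint: at most `k` allowed images per point. -/
def IsKConstraint (I : Instance) (k : ℕ) : Prop :=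
  ∀ a, (I.normalForm a).ncard ≤ k

end Instance

/-- `G` is an elementary Abelian `p`-group: it is Abelian and its non-trivial elements
have order `p`. -/
def IsElementaryAbelian {α : Type} (p : ℕ) (G : Subgroup (Perm α)) : Prop :=
  (∀ g ∈ G, ∀ h ∈ G, g * h = h * g) ∧ ∀ g ∈ G, g ≠ 1 → orderOf g = p

/-- The instances of GC restricted to elementary Abelian `p`-groups and `k`-constraints. -/
def RestrictedInstance (p k : ℕ) : Type :=
  {I : Instance // IsElementaryAbelian p I.group ∧ I.IsKConstraint k}

/-! ### Linear constraints -/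

namespace Instance

/-- The set of the orbits of `G`. -/
def orbits (I : Instance) : Set (Set (Fin I.n)) :=
  Set.range fun a => MulAction.orbit I.group a

/-- The transitive constituent of `G` on the orbit `O`: the restrictions to `O` of the elements
of `G`, extended to `A` by the identity outside `O`. -/
def constituent (I : Instance) (O : Set (Fin I.n)) : Set (Perm (Fin I.n)) :=
  {w | ∃ u ∈ I.group, (∀ a ∈ O, w a = u a) ∧ ∀ a ∉ O, w a = a}

/-- The super-space `F`, generated by the transitive constituents of `G`. -/
def superSpace (I : Instance) : Subgroup (Perm (Fin I.n)) :=
  Subgroup.closure (⋃ O ∈ I.orbits, I.constituent O)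

/-- The set `V_O` of the vectors of the constituent on `O` that map each `a ∈ O` into `𝒞 a`. -/
def allowed (I : Instance) (O : Set (Fin I.n)) : Set (Perm (Fin I.n)) :=
  {w | w ∈ I.constituent O ∧ ∀ a ∈ O, w a ∈ I.normalForm a}

/-- The sum `∑ V_O` over all orbits `O`, i.e. the set of the sums `∑ v_O` with `v_O ∈ V_O`. The
group is written multiplicatively; the factors of the product have disjoint supports, so that
they commute and their order is immaterial. -/
noncomputable def allowedSum (I : Instance) : Set (Perm (Fin I.n)) :=
  {w | ∃ v : Set (Fin I.n) → Perm (Fin I.n), (∀ O ∈ I.orbits, v O ∈ I.allowed O) ∧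
    w = ((Set.toFinite I.orbits).toFinset.toList.map v).prod}

/-- The constraint of `I` is linear: `∑ V_O` is empty or a linear variety of `F`, i.e. a translate
`v + H` of a subspace `H` of `F` by a `v ∈ F`. (The subspaces of an `𝔽_p`-vector space are its
subgroups.) -/
def IsLinear (I : Instance) : Prop :=
  I.allowedSum = ∅ ∨
    ∃ v ∈ I.superSpace, ∃ H : Subgroup (Perm (Fin I.n)), H ≤ I.superSpace ∧
      I.allowedSum = {u | ∃ h ∈ H, u = v * h}

end Instance

/-! ### Encodings and polynomial time -/

/-- A list of natural numbers as a bit string, each number `i` being written as `i` ones followed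
by a zero. Numbers in unary are adequate because the set `A` is given explicitly: all the numbers
that occur are bounded by `n` or by the length of a list that is written out. -/
def natsCode (l : List ℕ) : List Bool :=
  l.flatMap fun i => List.replicate i true ++ [false]

/-- The table `g 0, g 1, …, g (n - 1)` of a permutation. -/
def permTable {n : ℕ} (g : Perm (Fin n)) : List ℕ :=
  List.ofFn fun a => (g a : ℕ)

/-- An atomic constraint `x ^ σ ∈ X`: the point `x`, then the `n` entries of the indicator function
of `X`. -/
def atomTable {n : ℕ} (c : Fin n × Finset (Fin n)) : List ℕ :=
  (c.1 : ℕ) :: List.ofFn fun b => if b ∈ c.2 then 1 else 0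

/-- The input string of an instance: `n`, the number and the tables of the permutations, the number
and the tables of the atomic constraints. -/
def Instance.code (I : Instance) : List Bool :=
  natsCode ((I.n :: I.gens.length :: I.gens.flatMap permTable) ++
    (I.constraint.length :: I.constraint.flatMap atomTable))

/-- The output string of the search problem: a zero if there is no answer, otherwise a one followed
by the table of the permutation. -/
def answerCode {n : ℕ} : Option (Perm (Fin n)) → List Bool
  | none => [false]
  | some g => true :: natsCode (permTable g)

/-- The string-valued function `f` is computed, from the encoded input, by a Turing machine in time
polynomial in the length of that input. -/
def PolyTime {α : Type} (code : α → List Bool) (f : α → List Bool) : Prop :=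
  Nonempty (Turing.TM2ComputableInPolyTime code (id : List Bool → List Bool) f)

/-- The decision problem GC restricted to `p` and `k` is solvable in polynomial time. -/
def DecisionPolyTime (p k : ℕ) : Prop :=
  ∃ f : RestrictedInstance p k → Bool,
    (∀ I, f I = true ↔ ∃ g, I.1.IsSolution g) ∧
    PolyTime (fun I => I.1.code) (fun I => [f I])

/-- The search problem GC restricted to `p` and `k` is solvable in polynomial time: a solution
is output if there is one, and otherwise it is reported that there is none. -/
def SearchPolyTime (p k : ℕ) : Prop :=
  ∃ f : (I : RestrictedInstance p k) → Option (Perm (Fin I.1.n)),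
    (∀ I g, f I = some g → I.1.IsSolution g) ∧
    (∀ I, f I = none → ¬ ∃ g, I.1.IsSolution g) ∧
    PolyTime (fun I => I.1.code) (fun I => answerCode (f I))

end GroupConstraint

/-!
# The group constraint problem for elementary Abelian 2-groups and 2-constraints

**Algorithm.** Let `G` be a group of permutations of exponent two, hence Abelian. The elements of
`G` that satisfy the constraint at all the points considered so far are kept as a coset `v H`, with
`H` given by generators. To take a further point `a` into account, the stabilizer `K` of `a` in `H`
and representatives `t` of the cosets of `K` are computed by inserting the generators of `H` one by
one (`transversal`): a generator `h` for which some `t` has the same image of `a` contributes the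
element `h t` to the stabilizer, any other one doubles the set of representatives. The
representatives have distinct images of `a`, so there are at most `n` of them. The elements of `v H`
that map `a` to an allowed point form the union of the cosets `v t K` with `v t` mapping `a` to an
allowed point. In the case of a 2-constraint there are at most two such `t`, and since the exponent
is two, the union of `v t K` and `v t' K` is the coset of `v t` for the group generated by `t t'`
and `K` (`refineAt_spec`). At each point at most one generator is added, so the data stay of
polynomial size, and after all the points are processed, `v` is a solution (`solutions_spec`).

**Polynomial time.** Structured programs on four stacks of bits are compiled to Turing machines
(`Run.iterate_step`). They operate on binary trees, which are stored on the stacks in prefix code.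
The relation `Poly A B` says that one program turns `A i` into `B i` in time polynomial in the size
of `A i`, for all indices `i` of an arbitrary type. It is transitive and closed under pairing, case
distinction and iterations with polynomially many rounds and polynomially bounded intermediate
results (`Poly.trans`, `Poly.pair`, `Poly.cases`, `Poly.iterate`); from these follow the operations
on lists, numbers and permutations that the algorithm uses. Since the index type is arbitrary, the
steps of the algorithm are families over instances together with group elements, and the size bounds
follow from the bounds on the number of generators and of representatives.

**Linearity.** A constituent of an Abelian group is regular, so that a vector in `V_O` is determined
by the image of one point, and `V_O` has at most two elements. Hence among three elements `x, y, z`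
of `V_O` two are equal, and `x y z` is the third one, because the exponent is two. So `V_O`, and
then the sum of all the `V_O`, is closed under the sum of three vectors, which makes it empty or a
linear variety (`Instance.isLinear`).
-/

namespace GroupConstraint

open Turing

/-! ### A structured language for stack machines -/

/-- The four stacks of the machine. The stack `data` holds the operands and `ret` operands that have
been put aside; `aux` and `cnt` are empty between two operations on trees. -/
inductive Stk
  | data | ret | aux | cnt
  deriving DecidableEq

instance : Fintype Stk :=
  ⟨{.data, .ret, .aux, .cnt}, by rintro (_ | _ | _ | _) <;> decide⟩

/-- Structured programs over the four stacks. A test looks at the top of a stack, which is `none`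
when that stack is empty. -/
inductive Prog
  | push (k : Stk) (b : Bool)
  | pop (k : Stk)
  | seq (p q : Prog)
  | ite (k : Stk) (c : Option Bool → Bool) (p q : Prog)
  | loop (k : Stk) (c : Option Bool → Bool) (p : Prog)

/-- The contents of the stacks. -/
abbrev Store : Type := Stk → List Bool

/-- `Run p S t S'`: started on the store `S`, the program `p` stops with the store `S'` after
exactly `t` elementary steps (pushes, pops and tests). -/
inductive Run : Prog → Store → ℕ → Store → Prop
  | push (k b S) : Run (.push k b) S 1 (Function.update S k (b :: S k))
  | pop (k S) : Run (.pop k) S 1 (Function.update S k (S k).tail)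
  | seq {p q S t S' t' S''} : Run p S t S' → Run q S' t' S'' → Run (.seq p q) S (t + t') S''
  | ite_true {k c p S t S'} (q) : c (S k).head? = true → Run p S t S' →
      Run (.ite k c p q) S (1 + t) S'
  | ite_false {k c q S t S'} (p) : c (S k).head? = false → Run q S t S' →
      Run (.ite k c p q) S (1 + t) S'
  | loop_done {k c S} (p) : c (S k).head? = false → Run (.loop k c p) S 1 S
  | loop_step {k c p S t S' t' S''} : c (S k).head? = true → Run p S t S' →
      Run (.loop k c p) S' t' S'' → Run (.loop k c p) S (1 + (t + t')) S''

/-- The control points of a program. -/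
def Prog.Label : Prog → Type
  | .push _ _ => Unit
  | .pop _ => Unit
  | .seq p q => p.Label ⊕ q.Label
  | .ite _ _ p q => Option (p.Label ⊕ q.Label)
  | .loop _ _ p => Option p.Label

/-- The control point at which the execution starts. -/
def Prog.entry : (p : Prog) → p.Label
  | .push _ _ => ()
  | .pop _ => ()
  | .seq p _ => .inl p.entry
  | .ite _ _ _ _ => none
  | .loop _ _ _ => none

noncomputable instance Prog.fintypeLabel : (p : Prog) → Fintype p.Label
  | .push _ _ => inferInstanceAs (Fintype Unit)
  | .pop _ => inferInstanceAs (Fintype Unit)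
  | .seq p q =>
    have := p.fintypeLabel
    have := q.fintypeLabel
    inferInstanceAs (Fintype (p.Label ⊕ q.Label))
  | .ite _ _ p q =>
    have := p.fintypeLabel
    have := q.fintypeLabel
    inferInstanceAs (Fintype (Option (p.Label ⊕ q.Label)))
  | .loop _ _ p =>
    have := p.fintypeLabel
    inferInstanceAs (Fintype (Option p.Label))

/-- Statements over the four stacks of bits. The internal state of the machine is used only to
inspect the top of a stack; it is reset to `none` at the end of each statement. -/
abbrev MStmt (Λ : Type) : Type := TM2.Stmt (fun _ : Stk => Bool) Λ (Option Bool)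

/-- Continue at a given label, or halt. -/
def jump {Λ : Type} : Option Λ → MStmt Λ
  | none => .halt
  | some l => .goto fun _ => l

/-- Continue at one of two places, according to a test of the top of the stack `k`. -/
def testJump {Λ : Type} (k : Stk) (c : Option Bool → Bool) (l l' : Option Λ) : MStmt Λ :=
  .peek k (fun _ s => s) (.branch c (.load (fun _ => none) (jump l))
    (.load (fun _ => none) (jump l')))

/-- The statements of a program whose control points are placed in `Λ` by `f`, and which continues
at `e` (or halts, if `e` is `none`) when it is done. -/
def Prog.compile {Λ : Type} : (p : Prog) → (p.Label → Λ) → Option Λ → p.Label → MStmt Λ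
  | .push k b, _, e, _ => .push k (fun _ => b) (jump e)
  | .pop k, _, e, _ => .pop k (fun _ _ => none) (jump e)
  | .seq p q, f, e, l =>
    match l with
    | .inl l => p.compile (fun x => f (.inl x)) (some (f (.inr q.entry))) l
    | .inr l => q.compile (fun x => f (.inr x)) e l
  | .ite k c p q, f, e, l =>
    match l with
    | none => testJump k c (some (f (some (.inl p.entry)))) (some (f (some (.inr q.entry))))
    | some (.inl l) => p.compile (fun x => f (some (.inl x))) e l
    | some (.inr l) => q.compile (fun x => f (some (.inr x))) e l
  | .loop k c p, f, e, l =>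
    match l with
    | none => testJump k c (some (f (some p.entry))) e
    | some l => p.compile (fun x => f (some x)) (some (f none)) l

theorem stepAux_jump {Λ : Type} (e : Option Λ) (S : Store) :
    TM2.stepAux (jump e) none S = ⟨e, none, S⟩ := by
  cases e <;> rfl

theorem stepAux_testJump {Λ : Type} (k : Stk) (c : Option Bool → Bool) (l l' : Option Λ)
    (S : Store) : TM2.stepAux (testJump k c l l') none S =
      ⟨if c (S k).head? = true then l else l', none, S⟩ := by
  simp only [testJump, TM2.stepAux, stepAux_jump]
  cases c (S k).head? <;> rfl

/-- The compiled program simulates the structured one step by step. -/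
theorem Run.iterate_step {p : Prog} {S S' : Store} {t : ℕ} (h : Run p S t S') {Λ : Type}
    (M : Λ → MStmt Λ) (f : p.Label → Λ) (e : Option Λ) (hM : ∀ l, M (f l) = p.compile f e l) :
    (flip bind (TM2.step M))^[t] (some ⟨some (f p.entry), none, S⟩) = some ⟨e, none, S'⟩ := by
  have one (l : Λ) (S : Store) : flip bind (TM2.step M) (some ⟨some l, none, S⟩) =
    some (TM2.stepAux (M l) none S) := rfl
  induction h generalizing e with
  | push k b S =>
    rw [Function.iterate_one, one, hM]
    simp [Prog.compile, TM2.stepAux, stepAux_jump]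
  | pop k S =>
    rw [Function.iterate_one, one, hM]
    simp [Prog.compile, TM2.stepAux, stepAux_jump]
  | @seq p q S t S' t' S'' h₁ h₂ ih₁ ih₂ =>
    rw [add_comm, Function.iterate_add_apply]
    erw [ih₁ (fun x => f (.inl x)) (some (f (.inr q.entry))) fun l => hM (.inl l),
      ih₂ (fun x => f (.inr x)) e fun l => hM (.inr l)]
  | @ite_true k c p S t S' q hc h ih =>
    rw [add_comm, Function.iterate_add_apply, Function.iterate_one, one, hM]
    simp only [Prog.compile, Prog.entry, stepAux_testJump, hc, if_true]
    exact ih (fun x => f (some (.inl x))) e fun l => hM (some (.inl l))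
  | @ite_false k c q S t S' p hc h ih =>
    rw [add_comm, Function.iterate_add_apply, Function.iterate_one, one, hM]
    simp only [Prog.compile, Prog.entry, stepAux_testJump, hc]
    exact ih (fun x => f (some (.inr x))) e fun l => hM (some (.inr l))
  | @loop_done k c S p hc =>
    rw [Function.iterate_one, one, hM]
    simp [Prog.compile, Prog.entry, stepAux_testJump, hc]
  | @loop_step k c p S t S' t' S'' hc h₁ h₂ ih₁ ih₂ =>
    rw [add_comm, Function.iterate_add_apply, Function.iterate_one, one, hM]
    simp only [Prog.compile, Prog.entry, stepAux_testJump, hc, if_true]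
    rw [add_comm, Function.iterate_add_apply,
      ih₁ (fun x => f (some x)) (some (f none)) fun l => hM (some l)]
    exact ih₂ f e hM

/-- The store with the given stacks. -/
def store (d r x c : List Bool) : Store
  | .data => d
  | .ret => r
  | .aux => x
  | .cnt => c

section store

variable (d r x c l : List Bool)

@[simp] theorem store_data : store d r x c .data = d := rfl

@[simp] theorem store_ret : store d r x c .ret = r := rfl

@[simp] theorem store_aux : store d r x c .aux = x := rfl

@[simp] theorem store_cnt : store d r x c .cnt = c := rfl

@[simp] theorem update_store_data : Function.update (store d r x c) .data l = store l r x c := by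
  funext k; cases k <;> rfl

@[simp] theorem update_store_ret : Function.update (store d r x c) .ret l = store d l x c := by
  funext k; cases k <;> rfl

@[simp] theorem update_store_aux : Function.update (store d r x c) .aux l = store d r l c := by
  funext k; cases k <;> rfl

@[simp] theorem update_store_cnt : Function.update (store d r x c) .cnt l = store d r x l := by
  funext k; cases k <;> rfl

end store

/-- The machine of a program: the input is read from the stack `aux` and the output is left on the
stack `ret`. -/
noncomputable def Prog.machine (p : Prog) : FinTM2 where
  K := Stk
  k₀ := .aux
  k₁ := .ret
  Γ _ := Bool
  Λ := p.Label
  main := p.entry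
  σ := Option Bool
  initialState := none
  Γk₀Fin := inferInstanceAs (Fintype Bool)
  m := p.compile id none

/-- A program that runs in polynomial time yields a Turing machine that does so. All the stacks of
the machine have the alphabet `Bool`. -/
theorem polyTime_of_run {α : Type} {code f : α → List Bool} (p : Prog) (k : ℕ)
    (h : ∀ a, ∃ t ≤ ((code a).length + 2) ^ k,
      Run p (store [] [] (code a) []) t (store [] (f a) [] [])) : PolyTime code f := by
  choose t ht hr using h
  refine ⟨{ tm := p.machine, inputAlphabet := Equiv.refl _, outputAlphabet := Equiv.refl _,
            time := (Polynomial.X + 2) ^ k, outputsFun := fun a => ⟨⟨t a, ?_⟩, ?_⟩ }⟩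
  · have hi : initList p.machine (List.map (Equiv.refl Bool).invFun (code a)) =
        ⟨some p.entry, none, store [] [] (code a) []⟩ := by
      simp only [initList, Equiv.invFun_as_coe, Equiv.refl_symm, Equiv.coe_refl]
      congr 1
      funext k; cases k
      exacts [rfl, rfl, List.map_id _, rfl]
    have ho : haltList p.machine (List.map (Equiv.refl Bool).invFun (f a)) =
        ⟨none, none, store [] (f a) [] []⟩ := by
      simp only [haltList, Equiv.invFun_as_coe, Equiv.refl_symm, Equiv.coe_refl]
      congr 1
      funext k; cases k
      exacts [rfl, List.map_id _, rfl, rfl]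
    have := (hr a).iterate_step (p.compile id none) id none fun _ => rfl
    erw [hi]
    refine this.trans ?_
    erw [Option.map_some, ho]
    rfl
  · simpa using ht a

/-! ### Polynomial bounds -/

/-- `f` is bounded by a polynomial in `g`, written as a single power. -/
def PolyBound {ι : Type} (f g : ι → ℕ) : Prop :=
  ∃ k, ∀ i, f i ≤ (g i + 2) ^ k

namespace PolyBound

variable {ι κ : Type} {f f' g h : ι → ℕ}

theorem mono (hf : PolyBound f g) (h : ∀ i, f' i ≤ f i) : PolyBound f' g :=
  let ⟨k, hk⟩ := hf
  ⟨k, fun i => (h i).trans (hk i)⟩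

theorem self (g : ι → ℕ) : PolyBound g g :=
  ⟨1, fun i => by simp⟩

theorem of_le (h : ∀ i, f i ≤ g i) : PolyBound f g :=
  (self g).mono h

theorem const (c : ℕ) (g : ι → ℕ) : PolyBound (fun _ => c) g :=
  ⟨c, fun i => (Nat.lt_two_pow_self.le).trans (Nat.pow_le_pow_left (by omega) c)⟩

theorem add (hf : PolyBound f h) (hg : PolyBound g h) : PolyBound (fun i => f i + g i) h := by
  obtain ⟨k, hk⟩ := hf
  obtain ⟨l, hl⟩ := hg
  refine ⟨max k l + 1, fun i => ?_⟩
  have h1 := (hk i).trans (Nat.pow_le_pow_right (by omega) (le_max_left k l))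
  have h2 := (hl i).trans (Nat.pow_le_pow_right (by omega) (le_max_right k l))
  rw [pow_succ]
  nlinarith

theorem mul (hf : PolyBound f h) (hg : PolyBound g h) : PolyBound (fun i => f i * g i) h := by
  obtain ⟨k, hk⟩ := hf
  obtain ⟨l, hl⟩ := hg
  exact ⟨k + l, fun i => by rw [pow_add]; exact Nat.mul_le_mul (hk i) (hl i)⟩

theorem pow (hf : PolyBound f h) (c : ℕ) : PolyBound (fun i => f i ^ c) h := by
  obtain ⟨k, hk⟩ := hf
  exact ⟨k * c, fun i => by rw [pow_mul]; exact Nat.pow_le_pow_left (hk i) c⟩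

theorem trans (hf : PolyBound f g) (hg : PolyBound g h) : PolyBound f h := by
  obtain ⟨k, hk⟩ := hf
  exact ((hg.add (const 2 h)).pow k).mono hk

theorem reindex (hf : PolyBound f g) (φ : κ → ι) :
    PolyBound (fun j => f (φ j)) (fun j => g (φ j)) :=
  let ⟨k, hk⟩ := hf
  ⟨k, fun j => hk (φ j)⟩

end PolyBound

/-! ### Binary trees on a stack -/

/-- Binary trees, the data of the programs. -/
inductive BTree
  | nil
  | cons (a b : BTree)

namespace BTree

/-- The prefix code of a tree. -/
def code : BTree → List Bool
  | nil => [false]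
  | cons a b => true :: (a.code ++ b.code)

/-- The length of the code of a tree. -/
def size : BTree → ℕ
  | nil => 1
  | cons a b => a.size + b.size + 1

@[simp] theorem length_code (t : BTree) : t.code.length = t.size := by
  induction t with
  | nil => rfl
  | cons a b iha ihb => simp [code, size, iha, ihb]

theorem size_pos (t : BTree) : 0 < t.size := by
  cases t <;> simp [size]

end BTree

open BTree

/-- The program `p` leads from `S` to `S'` in at most `t` steps. -/
def RunLE (p : Prog) (S : Store) (t : ℕ) (S' : Store) : Prop :=
  ∃ s ≤ t, Run p S s S'

namespace RunLE

variable {p q : Prog} {S S' S'' : Store} {t t' : ℕ} {k : Stk} {c : Option Bool → Bool}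
  (d r x n : List Bool)

theorem mono (h : RunLE p S t S') (htt : t ≤ t') : RunLE p S t' S' :=
  let ⟨s, hs, hr⟩ := h
  ⟨s, hs.trans htt, hr⟩

theorem seq (h : RunLE p S t S') (h' : RunLE q S' t' S'') : RunLE (.seq p q) S (t + t') S'' :=
  let ⟨s, hs, hr⟩ := h
  let ⟨s', hs', hr'⟩ := h'
  ⟨s + s', add_le_add hs hs', hr.seq hr'⟩

theorem ite_true (hc : c (S k).head? = true) (h : RunLE p S t S') :
    RunLE (.ite k c p q) S (t + 1) S' :=
  let ⟨s, hs, hr⟩ := h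
  ⟨1 + s, by omega, hr.ite_true q hc⟩

theorem ite_false (hc : c (S k).head? = false) (h : RunLE q S t S') :
    RunLE (.ite k c p q) S (t + 1) S' :=
  let ⟨s, hs, hr⟩ := h
  ⟨1 + s, by omega, hr.ite_false p hc⟩

theorem loop_done (hc : c (S k).head? = false) : RunLE (.loop k c p) S 1 S :=
  ⟨1, le_rfl, .loop_done p hc⟩

theorem loop_step (hc : c (S k).head? = true) (h : RunLE p S t S')
    (h' : RunLE (.loop k c p) S' t' S'') : RunLE (.loop k c p) S (t + t' + 1) S'' :=
  let ⟨s, hs, hr⟩ := h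
  let ⟨s', hs', hr'⟩ := h'
  ⟨1 + (s + s'), by omega, .loop_step hc hr hr'⟩

theorem push_data (b : Bool) : RunLE (.push .data b) (store d r x n) 1 (store (b :: d) r x n) :=
  ⟨1, le_rfl, by simpa using Run.push .data b (store d r x n)⟩

theorem push_ret (b : Bool) : RunLE (.push .ret b) (store d r x n) 1 (store d (b :: r) x n) :=
  ⟨1, le_rfl, by simpa using Run.push .ret b (store d r x n)⟩

theorem push_aux (b : Bool) : RunLE (.push .aux b) (store d r x n) 1 (store d r (b :: x) n) :=
  ⟨1, le_rfl, by simpa using Run.push .aux b (store d r x n)⟩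

theorem push_cnt (b : Bool) : RunLE (.push .cnt b) (store d r x n) 1 (store d r x (b :: n)) :=
  ⟨1, le_rfl, by simpa using Run.push .cnt b (store d r x n)⟩

theorem pop_data (b : Bool) : RunLE (.pop .data) (store (b :: d) r x n) 1 (store d r x n) :=
  ⟨1, le_rfl, by simpa using Run.pop .data (store (b :: d) r x n)⟩

theorem pop_ret (b : Bool) : RunLE (.pop .ret) (store d (b :: r) x n) 1 (store d r x n) :=
  ⟨1, le_rfl, by simpa using Run.pop .ret (store d (b :: r) x n)⟩

theorem pop_aux (b : Bool) : RunLE (.pop .aux) (store d r (b :: x) n) 1 (store d r x n) :=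
  ⟨1, le_rfl, by simpa using Run.pop .aux (store d r (b :: x) n)⟩

theorem pop_cnt (b : Bool) : RunLE (.pop .cnt) (store d r x (b :: n)) 1 (store d r x n) :=
  ⟨1, le_rfl, by simpa using Run.pop .cnt (store d r x (b :: n))⟩

end RunLE

/-- The test whether the top of a stack is `true`. -/
def topTrue (o : Option Bool) : Bool :=
  o == some true

/-- The body of the loop of `Prog.load`. -/
def Prog.loadBody (k : Stk) : Prog :=
  .ite k topTrue (.seq (.pop k) (.seq (.push .aux true) (.push .cnt true)))
    (.seq (.pop k) (.seq (.push .aux false) (.pop .cnt)))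

/-- Move the tree on the top of the stack `k` to `aux`, reversing its code. The end of the code is
found by counting on `cnt` the subtrees that are still to come. -/
def Prog.load (k : Stk) : Prog :=
  .seq (.push .cnt true) (.loop .cnt Option.isSome (.loadBody k))

/-- Prefix codes are self-delimiting: reading a tree removes exactly one mark from `cnt`. The lemma
is stated for the rest of the loop, so that it can be applied to the two subtrees in turn. -/
theorem runLE_load_data_loop (t : BTree) {d r x n : List Bool} {T : ℕ} {S : Store}
    (h : RunLE (.loop .cnt Option.isSome (.loadBody .data))
      (store d r (t.code.reverse ++ x) n) T S) :
    RunLE (.loop .cnt Option.isSome (.loadBody .data))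
      (store (t.code ++ d) r x (true :: n)) (T + 5 * t.size) S := by
  induction t generalizing d x n T with
  | nil =>
    refine (RunLE.loop_step rfl (.ite_false rfl (.seq (.pop_data _ _ _ _ _)
      (.seq (.push_aux _ _ _ _ _) (.pop_cnt _ _ _ _ _)))) h).mono ?_
    simp only [size]; omega
  | cons a b iha ihb =>
    have h' := iha (d := b.code ++ d) (x := true :: x) (n := true :: n)
      (ihb (d := d) (by simpa [code] using h))
    rw [code, List.cons_append, List.append_assoc]
    refine (RunLE.loop_step rfl (.ite_true rfl (.seq (.pop_data _ _ _ _ _)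
      (.seq (.push_aux _ _ _ _ _) (.push_cnt _ _ _ _ _)))) h').mono ?_
    simp only [size]; omega

theorem runLE_load_ret_loop (t : BTree) {d r x n : List Bool} {T : ℕ} {S : Store}
    (h : RunLE (.loop .cnt Option.isSome (.loadBody .ret))
      (store d r (t.code.reverse ++ x) n) T S) :
    RunLE (.loop .cnt Option.isSome (.loadBody .ret))
      (store d (t.code ++ r) x (true :: n)) (T + 5 * t.size) S := by
  induction t generalizing r x n T with
  | nil =>
    refine (RunLE.loop_step rfl (.ite_false rfl (.seq (.pop_ret _ _ _ _ _)
      (.seq (.push_aux _ _ _ _ _) (.pop_cnt _ _ _ _ _)))) h).mono ?_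
    simp only [size]; omega
  | cons a b iha ihb =>
    have h' := iha (r := b.code ++ r) (x := true :: x) (n := true :: n)
      (ihb (r := r) (by simpa [code] using h))
    rw [code, List.cons_append, List.append_assoc]
    refine (RunLE.loop_step rfl (.ite_true rfl (.seq (.pop_ret _ _ _ _ _)
      (.seq (.push_aux _ _ _ _ _) (.push_cnt _ _ _ _ _)))) h').mono ?_
    simp only [size]; omega

theorem runLE_load_data (t : BTree) (d r : List Bool) :
    RunLE (.load .data) (store (t.code ++ d) r [] []) (5 * t.size + 2)
      (store d r t.code.reverse []) := by
  refine (RunLE.seq (.push_cnt _ _ _ _ _) (runLE_load_data_loop t (T := 1) ?_)).mono (by omega)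
  simpa using RunLE.loop_done rfl

theorem runLE_load_ret (t : BTree) (d r : List Bool) :
    RunLE (.load .ret) (store d (t.code ++ r) [] []) (5 * t.size + 2)
      (store d r t.code.reverse []) := by
  refine (RunLE.seq (.push_cnt _ _ _ _ _) (runLE_load_ret_loop t (T := 1) ?_)).mono (by omega)
  simpa using RunLE.loop_done rfl

/-- Remove the bit `b` from `aux` and push it on `data` and on `ret`, as told by the two flags. -/
def Prog.emit : Bool → Bool → Bool → Prog
  | true, true, b => .seq (.pop .aux) (.seq (.push .data b) (.push .ret b))
  | true, false, b => .seq (.pop .aux) (.push .data b)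
  | false, true, b => .seq (.pop .aux) (.push .ret b)
  | false, false, _ => .pop .aux

/-- Empty `aux`, moving its contents to `data` and to `ret`, as told by the two flags. -/
def Prog.spill (u v : Bool) : Prog :=
  .loop .aux Option.isSome (.ite .aux topTrue (.emit u v true) (.emit u v false))

theorem runLE_emit (u v b : Bool) (d r x : List Bool) :
    RunLE (.emit u v b) (store d r (b :: x) []) 3
      (store (if u then b :: d else d) (if v then b :: r else r) x []) := by
  have hp := RunLE.pop_aux d r x [] b
  cases u <;> cases v
  · exact hp.mono (by omega)
  · exact (hp.seq (.push_ret _ _ _ _ b)).mono (by omega)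
  · exact (hp.seq (.push_data _ _ _ _ b)).mono (by omega)
  · exact (hp.seq (.seq (.push_data _ _ _ _ b) (.push_ret _ _ _ _ b))).mono (by omega)

theorem runLE_spill (u v : Bool) (d r x : List Bool) :
    RunLE (.spill u v) (store d r x []) (5 * x.length + 1)
      (store (if u then x.reverse ++ d else d) (if v then x.reverse ++ r else r) [] []) := by
  induction x generalizing d r with
  | nil => simpa [Prog.spill] using RunLE.loop_done rfl
  | cons b x ih =>
    have h1 : RunLE (.ite .aux topTrue (.emit u v true) (.emit u v false))
        (store d r (b :: x) []) 4
        (store (if u then b :: d else d) (if v then b :: r else r) x []) := by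
      cases b
      · exact .ite_false rfl (runLE_emit u v false d r x)
      · exact .ite_true rfl (runLE_emit u v true d r x)
    have h2 := RunLE.loop_step (k := .aux) (c := Option.isSome) rfl h1 (ih _ _)
    have h3 := h2.mono (t' := 5 * (b :: x).length + 1) (by simp; omega)
    cases u <;> cases v <;> simpa [Prog.spill] using h3

/-- Move, copy or delete the tree on the top of `data`: it is removed from there and pushed on
`data` and on `ret`, as told by the two flags. -/
def Prog.fromData (u v : Bool) : Prog :=
  .seq (.load .data) (.spill u v)

/-- Move the tree on the top of `ret` to `data`. -/
def Prog.fromRet : Prog :=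
  .seq (.load .ret) (.spill true false)

theorem runLE_fromData (u v : Bool) (t : BTree) (d r : List Bool) :
    RunLE (.fromData u v) (store (t.code ++ d) r [] []) (10 * t.size + 3)
      (store (if u then t.code ++ d else d) (if v then t.code ++ r else r) [] []) := by
  have := ((runLE_load_data t d r).seq (runLE_spill u v d r _)).mono (t' := 10 * t.size + 3)
    (by simp; omega)
  simpa [Prog.fromData] using this

theorem runLE_fromRet (t : BTree) (d r : List Bool) :
    RunLE .fromRet (store d (t.code ++ r) [] []) (10 * t.size + 3)
      (store (t.code ++ d) r [] []) := by
  have := ((runLE_load_ret t d r).seq (runLE_spill true false d r _)).mono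
    (t' := 10 * t.size + 3) (by simp; omega)
  simpa [Prog.fromRet] using this

/-- A step adds at most one bit, so that the running time bounds the size of the output. -/
theorem Run.length_data_le {p : Prog} {S S' : Store} {t : ℕ} (h : Run p S t S') :
    (S' .data).length ≤ (S .data).length + t := by
  induction h with
  | push k b S => cases k <;> simp [Function.update]
  | pop k S => cases k <;> simp [Function.update]; omega
  | _ => omega

/-! ### Functions on trees in polynomial time -/

/-- `Poly A B`: a single program replaces, for each index `i`, the tree `A i` on the top of `data`
by the tree `B i`, in time polynomial in the size of `A i`. The index type is arbitrary, so that `A`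
and `B` can be encodings of values of types that depend on the index. -/
def Poly {ι : Type} (A B : ι → BTree) : Prop :=
  ∃ (p : Prog) (T : ι → ℕ), PolyBound T (fun i => (A i).size) ∧ ∀ i d r,
    RunLE p (store ((A i).code ++ d) r [] []) (T i) (store ((B i).code ++ d) r [] [])

namespace Poly

variable {ι κ : Type} {A B C : ι → BTree}

theorem refl (A : ι → BTree) : Poly A A :=
  ⟨.seq (.push .data true) (.pop .data), fun _ => 2, .const 2 _, fun _ _ _ =>
    .seq (.push_data _ _ _ _ _) (.pop_data _ _ _ _ _)⟩

theorem polyBound (h : Poly A B) : PolyBound (fun i => (B i).size) (fun i => (A i).size) := by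
  obtain ⟨p, T, hT, h⟩ := h
  refine ((PolyBound.self _).add hT).mono fun i => ?_
  obtain ⟨s, hs, hr⟩ := h i [] []
  have := hr.length_data_le
  simp at this
  omega

theorem trans (h : Poly A B) (h' : Poly B C) : Poly A C := by
  have hb := h.polyBound
  obtain ⟨p, T, hT, h⟩ := h
  obtain ⟨q, T', hT', h'⟩ := h'
  exact ⟨.seq p q, _, hT.add (hT'.trans hb), fun i d r => (h i d r).seq (h' i d r)⟩

theorem reindex (h : Poly A B) (φ : κ → ι) : Poly (fun j => A (φ j)) (fun j => B (φ j)) :=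
  let ⟨p, T, hT, h⟩ := h
  ⟨p, fun j => T (φ j), hT.reindex φ, fun j => h (φ j)⟩

theorem congr (h : Poly A B) (hBC : ∀ i, B i = C i) : Poly A C := by
  rwa [← funext hBC]

theorem nil : Poly A (fun _ => BTree.nil) :=
  ⟨.seq (.fromData false false) (.push .data false), _,
    ((PolyBound.const 10 _).mul (.self _)).add (.const 4 _),
    fun i d r => ((runLE_fromData false false (A i) d r).seq (.push_data _ _ _ _ _))⟩

theorem pair (hB : Poly A B) (hC : Poly A C) : Poly A (fun i => (B i).cons (C i)) := by
  obtain ⟨p, T, hT, h⟩ := hB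
  obtain ⟨q, T', hT', h'⟩ := hC
  -- Save a copy of the input, compute the second component, then the first one on top of it; the
  -- code of the pair begins with one more bit.
  refine ⟨.seq (.fromData true true) (.seq q (.seq .fromRet (.seq p (.push .data true)))),
    fun i => (10 * (A i).size + 3) + (T' i + ((10 * (A i).size + 3) + (T i + 1))), ?_,
    fun i d r => ?_⟩
  · have := ((PolyBound.const 10 _).mul (.self fun i => (A i).size)).add (.const 3 _)
    exact this.add (hT'.add (this.add (hT.add (.const 1 _))))
  · have := (runLE_fromData true true (A i) d r).seq ((h' i _ _).seq
      ((runLE_fromRet (A i) _ r).seq ((h i _ _).seq (.push_data _ _ _ _ true))))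
    simpa [code] using this

theorem fst (h : Poly A (fun i => (B i).cons (C i))) : Poly A B := by
  refine h.trans ⟨.seq (.pop .data) (.seq (.fromData false true) (.seq (.fromData false false)
    .fromRet)), fun i => 1 + ((10 * (B i).size + 3) + ((10 * (C i).size + 3) +
      (10 * (B i).size + 3))), ?_, fun i d r => ?_⟩
  · refine ((PolyBound.const 30 _).mul (.self _)).mono fun i => ?_
    simp only [size]; omega
  · have := (RunLE.pop_data ((B i).code ++ ((C i).code ++ d)) r [] [] true).seq
      ((runLE_fromData false true (B i) _ r).seq ((runLE_fromData false false (C i) _ _).seq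
        (runLE_fromRet (B i) _ r)))
    simpa [code] using this

theorem snd (h : Poly A (fun i => (B i).cons (C i))) : Poly A C := by
  refine h.trans ⟨.seq (.pop .data) (.fromData false false), fun i => 1 + (10 * (B i).size + 3),
    ?_, fun i d r => ?_⟩
  · refine ((PolyBound.const 10 _).mul (.self _)).mono fun i => ?_
    simp only [size]; omega
  · have := (RunLE.pop_data ((B i).code ++ ((C i).code ++ d)) r [] [] true).seq
      (runLE_fromData false false (B i) _ r)
    simpa [code] using this

theorem const (t : BTree) : Poly A (fun _ => t) := by
  induction t with
  | nil => exact nil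
  | cons a b iha ihb => exact iha.pair ihb

/-- Case distinction. The two branches are families over the indices of the respective case. -/
theorem cases (hC : Poly A C)
    (h : Poly (fun i : {i // C i = .nil} => A i) (fun i => B i))
    (h' : Poly (fun i : {i // C i ≠ .nil} => A i) (fun i => B i)) : Poly A B := by
  have hCA := hC.pair (refl A)
  have hb := hC.polyBound
  refine hCA.trans ?_
  obtain ⟨p, T, ⟨k, hT⟩, h⟩ := h
  obtain ⟨q, T', ⟨l, hT'⟩, h'⟩ := h'
  refine ⟨.seq (.pop .data) (.ite .data topTrue (.seq (.fromData false false) q)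
    (.seq (.fromData false false) p)), fun i => 1 + ((10 * (C i).size + 3 +
      (((A i).size + 2) ^ k + ((A i).size + 2) ^ l)) + 1), ?_, fun i d r => ?_⟩
  · have hA : PolyBound (fun i => (A i).size) (fun i => ((C i).cons (A i)).size) :=
      .of_le fun i => by simp only [size]; omega
    have hC : PolyBound (fun i => (C i).size) (fun i => ((C i).cons (A i)).size) :=
      .of_le fun i => by simp only [size]; omega
    exact (PolyBound.const 1 _).add (((((PolyBound.const 10 _).mul hC).add (.const 3 _)).add
      (((hA.add (.const 2 _)).pow k).add ((hA.add (.const 2 _)).pow l))).add (.const 1 _))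
  · rw [code, List.cons_append, List.append_assoc]
    refine (RunLE.pop_data _ _ _ _ _).seq ?_
    have hd := runLE_fromData false false (C i) ((A i).code ++ d) r
    by_cases hi : C i = .nil
    · refine .ite_false ?_ ((hd.seq ((h ⟨i, hi⟩ d r).mono ((hT ⟨i, hi⟩).trans ?_))))
      · simp [hi, code, topTrue]
      · simp
    · refine .ite_true ?_ ((hd.seq ((h' ⟨i, hi⟩ d r).mono ((hT' ⟨i, hi⟩).trans ?_))))
      · obtain ⟨a, b, hab⟩ : ∃ a b, C i = .cons a b := by
          cases hc : C i with
          | nil => exact absurd hc hi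
          | cons a b => exact ⟨a, b, rfl⟩
        simp [hab, code, topTrue]
      · simp

/-- Iteration. The number `N i` of rounds and the size of the trees that occur are polynomially
bounded; `U i k` is not `nil` as long as there are rounds to come. -/
theorem iterate {U V : ι → ℕ → BTree} {N : ι → ℕ}
    (hU : ∀ i, ∀ k < N i, U i k ≠ .nil) (hUN : ∀ i, U i (N i) = .nil)
    (init : Poly A fun i => (U i 0).cons (V i 0))
    (step : Poly (fun j : {j : ι × ℕ // j.2 < N j.1} => (U j.1.1 j.1.2).cons (V j.1.1 j.1.2))
      (fun j => (U j.1.1 (j.1.2 + 1)).cons (V j.1.1 (j.1.2 + 1))))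
    (hN : PolyBound N fun i => (A i).size)
    (hsize : PolyBound
      (fun j : {j : ι × ℕ // j.2 < N j.1} => ((U j.1.1 j.1.2).cons (V j.1.1 j.1.2)).size)
      (fun j => (A j.1.1).size)) :
    Poly A fun i => V i (N i) := by
  obtain ⟨p, T, hT, hp⟩ := init
  obtain ⟨q, T', hT', hq⟩ := step
  obtain ⟨l, hl⟩ := hT'.trans hsize
  -- Between two rounds `U i k` and `V i k` lie separately on the stack, so that the top bit tells
  -- whether `U i k` is `nil`.
  refine ⟨.seq p (.seq (.pop .data) (.seq (.loop .data topTrue (.seq (.push .data true)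
    (.seq q (.pop .data)))) (.pop .data))),
    fun i => T i + (1 + ((N i * (((A i).size + 2) ^ l + 3) + 1) + 1)), ?_, fun i d r => ?_⟩
  · exact hT.add ((PolyBound.const 1 _).add (((hN.mul (((PolyBound.self _).add (.const 2 _)).pow l
      |>.add (.const 3 _))).add (.const 1 _)).add (.const 1 _)))
  · refine (hp i d r).seq ?_
    rw [code, List.cons_append, List.append_assoc]
    refine (RunLE.pop_data _ _ _ _ _).seq (.seq (S' := store (false :: ((V i (N i)).code ++ d)) r
      [] []) ?_ (.pop_data _ _ _ _ _))
    -- The loop when `m` rounds are still to come.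
    have main : ∀ m k, k + m = N i → RunLE (.loop .data topTrue (.seq (.push .data true)
        (.seq q (.pop .data)))) (store ((U i k).code ++ ((V i k).code ++ d)) r [] [])
        (m * (((A i).size + 2) ^ l + 3) + 1)
        (store (false :: ((V i (N i)).code ++ d)) r [] []) := by
      intro m
      induction m with
      | zero =>
        intro k hk
        obtain rfl : k = N i := hk
        rw [hUN, code]
        exact RunLE.loop_done rfl |>.mono (by omega)
      | succ m ih =>
        intro k hk
        have hkN : k < N i := by omega
        have hs := hq ⟨(i, k), hkN⟩ d r
        simp only [code, List.cons_append, List.append_assoc] at hs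
        obtain ⟨a, b, hab⟩ : ∃ a b, U i k = .cons a b := by
          cases hc : U i k with
          | nil => exact absurd hc (hU i k hkN)
          | cons a b => exact ⟨a, b, rfl⟩
        refine (RunLE.loop_step (by simp [hab, code, topTrue]) (.seq (.push_data _ _ _ _ _)
          (hs.seq (.pop_data _ _ _ _ _))) (ih (k + 1) (by omega))).mono ?_
        have := hl ⟨(i, k), hkN⟩
        dsimp only at this
        rw [Nat.succ_mul]
        omega
    exact main (N i) 0 (by omega)

end Poly

open Equiv

/-! ### Encoding of data by trees -/

/-- The tree of a list of trees. -/
def listTree : List BTree → BTree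
  | [] => .nil
  | a :: l => .cons a (listTree l)

/-- Encoding of the values of a type by trees. The encoding need not be injective, so that an
element of a subtype is encoded as an element of the ambient type. -/
class ToTree (α : Type) where
  /-- The tree of a value. -/
  tr : α → BTree

open ToTree

instance : ToTree Unit := ⟨fun _ => .nil⟩

instance : ToTree Bool := ⟨fun b => if b then .cons .nil .nil else .nil⟩

instance {α : Type} [ToTree α] : ToTree (List α) := ⟨fun l => listTree (l.map tr)⟩

/-- Numbers are encoded in unary. -/
instance : ToTree ℕ := ⟨fun n => tr (List.replicate n ())⟩

instance {n : ℕ} : ToTree (Fin n) := ⟨fun a => tr (a : ℕ)⟩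

instance {α β : Type} [ToTree α] [ToTree β] : ToTree (α × β) := ⟨fun x => .cons (tr x.1) (tr x.2)⟩

instance {α : Type} [ToTree α] : ToTree (Option α) := ⟨fun o => tr o.toList⟩

theorem tr_cons {α : Type} [ToTree α] (a : α) (l : List α) :
    tr (a :: l) = .cons (tr a) (tr l) := rfl

theorem tr_nat (n : ℕ) : tr n = tr (List.replicate n ()) := rfl

theorem tr_map {α β : Type} [ToTree α] [ToTree β] (f : α → β) (h : ∀ a, tr (f a) = tr a)
    (l : List α) : tr (l.map f) = tr l := by
  change listTree _ = listTree _
  rw [List.map_map]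
  congr 1
  exact List.map_congr_left fun a _ => h a

theorem tr_eq_nil {α : Type} [ToTree α] {l : List α} : tr l = .nil ↔ l = [] := by
  cases l <;> simp [tr, listTree]

section size

variable {α : Type} [ToTree α]

theorem size_cons (a : α) (l : List α) : (tr (a :: l)).size = (tr a).size + (tr l).size + 1 := rfl

theorem length_lt_size (l : List α) : l.length < (tr l).size := by
  induction l with
  | nil => exact Nat.one_pos
  | cons a l ih => rw [size_cons, List.length_cons]; omega

theorem size_append (l m : List α) : (tr (l ++ m)).size + 1 = (tr l).size + (tr m).size := by
  induction l with
  | nil => exact Nat.add_comm _ 1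
  | cons a l ih => rw [List.cons_append, size_cons, size_cons]; omega

theorem size_lt_of_mem {a : α} {l : List α} (h : a ∈ l) : (tr a).size < (tr l).size := by
  induction l with
  | nil => simp at h
  | cons b l ih =>
    rw [size_cons]
    rcases List.mem_cons.1 h with rfl | h
    · omega
    · have := ih h
      omega

theorem size_drop_le (l : List α) (k : ℕ) : (tr (l.drop k)).size ≤ (tr l).size := by
  have := size_append (l.take k) (l.drop k)
  rw [List.take_append_drop] at this
  have := size_pos (tr (l.take k))
  omega

theorem size_take_le (l : List α) (k : ℕ) : (tr (l.take k)).size ≤ (tr l).size := by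
  have := size_append (l.take k) (l.drop k)
  rw [List.take_append_drop] at this
  have := size_pos (tr (l.drop k))
  omega

theorem size_reverse (l : List α) : (tr l.reverse).size = (tr l).size := by
  induction l with
  | nil => rfl
  | cons a l ih =>
    have := size_append l.reverse [a]
    have h1 : (tr [a]).size = (tr a).size + 1 + 1 := rfl
    rw [List.reverse_cons, size_cons]
    omega

theorem size_le_of_forall {l : List α} {b : ℕ} (h : ∀ a ∈ l, (tr a).size ≤ b) :
    (tr l).size ≤ l.length * (b + 1) + 1 := by
  induction l with
  | nil => simp [tr, listTree, size]
  | cons a l ih =>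
    have h1 := h a List.mem_cons_self
    have h2 := ih fun x hx => h x (List.mem_cons_of_mem _ hx)
    rw [size_cons, List.length_cons, Nat.succ_mul]
    omega

theorem size_nat (n : ℕ) : (tr n).size = 2 * n + 1 := by
  induction n with
  | zero => rfl
  | succ n ih =>
    have : (tr (n + 1)).size = 1 + (tr n).size + 1 := rfl
    omega

theorem size_bool_le (b : Bool) : (tr b).size ≤ 3 := by
  cases b <;> decide

end size

/-! ### Input and output of the machine -/

/-- Replace the bits on `aux` by their tree on `data`. -/
def Prog.input : Prog :=
  .seq (.spill false true) (.seq (.push .data false) (.loop .ret Option.isSome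
    (.ite .ret topTrue
      (.seq (.pop .ret) (.seq (.push .data false) (.seq (.push .data false)
        (.seq (.push .data true) (.push .data true)))))
      (.seq (.pop .ret) (.seq (.push .data false) (.push .data true))))))

theorem runLE_input (l : List Bool) :
    RunLE .input (store [] [] l []) (13 * l.length + 3) (store (tr l).code [] [] []) := by
  have main : ∀ (r l : List Bool), RunLE (.loop .ret Option.isSome
    (.ite .ret topTrue
      (.seq (.pop .ret) (.seq (.push .data false) (.seq (.push .data false)
        (.seq (.push .data true) (.push .data true)))))
      (.seq (.pop .ret) (.seq (.push .data false) (.push .data true)))))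
      (store (tr l).code r [] []) (7 * r.length + 1)
      (store (tr (r.reverse ++ l)).code [] [] []) := by
    intro r
    induction r with
    | nil => exact fun l => (RunLE.loop_done rfl).mono (by simp)
    | cons b r ih =>
      intro l
      have := ih (b :: l)
      rw [List.reverse_cons, List.append_assoc, List.length_cons]
      cases b
      · exact (RunLE.loop_step rfl (.ite_false rfl (.seq (.pop_ret _ _ _ _ _)
          (.seq (.push_data _ _ _ _ _) (.push_data _ _ _ _ _)))) this).mono (by omega)
      · exact (RunLE.loop_step rfl (.ite_true rfl (.seq (.pop_ret _ _ _ _ _)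
          (.seq (.push_data _ _ _ _ _) (.seq (.push_data _ _ _ _ _)
            (.seq (.push_data _ _ _ _ _) (.push_data _ _ _ _ _)))))) this).mono (by omega)
  have h := main l.reverse []
  rw [List.reverse_reverse, List.append_nil, List.length_reverse] at h
  have h0 := runLE_spill false true [] [] l
  simp only [Bool.false_eq_true, if_false, if_true, List.append_nil] at h0
  exact (h0.seq ((RunLE.push_data _ _ _ _ _).seq h)).mono (by omega)

/-- Replace the tree of a list of bits on `data` by these bits on `ret`. -/
def Prog.output : Prog :=
  .seq (.loop .data topTrue (.seq (.pop .data) (.ite .data topTrue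
      (.seq (.pop .data) (.seq (.pop .data) (.seq (.pop .data) (.push .aux true))))
      (.seq (.pop .data) (.push .aux false)))))
    (.seq (.pop .data) (.spill false true))

theorem runLE_output (l : List Bool) :
    RunLE .output (store (tr l).code [] [] []) (12 * l.length + 3) (store [] l [] []) := by
  have main : ∀ (l x : List Bool), RunLE (.loop .data topTrue (.seq (.pop .data)
      (.ite .data topTrue
        (.seq (.pop .data) (.seq (.pop .data) (.seq (.pop .data) (.push .aux true))))
        (.seq (.pop .data) (.push .aux false)))))
      (store (tr l).code [] x []) (7 * l.length + 1) (store [false] [] (l.reverse ++ x) []) := by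
    intro l
    induction l with
    | nil => exact fun l => (RunLE.loop_done rfl).mono (by simp)
    | cons b l ih =>
      intro x
      have := ih (b :: x)
      rw [List.reverse_cons, List.append_assoc, List.length_cons]
      cases b
      · exact (RunLE.loop_step rfl (.seq (.pop_data _ _ _ _ _) (.ite_false rfl
          (.seq (.pop_data _ _ _ _ _) (.push_aux _ _ _ _ _)))) this).mono (by omega)
      · exact (RunLE.loop_step rfl (.seq (.pop_data _ _ _ _ _) (.ite_true rfl
          (.seq (.pop_data _ _ _ _ _) (.seq (.pop_data _ _ _ _ _) (.seq (.pop_data _ _ _ _ _)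
            (.push_aux _ _ _ _ _)))))) this).mono (by omega)
  have h := main l []
  have h0 := runLE_spill false true [] [] (l.reverse ++ [])
  simp only [Bool.false_eq_true, if_false, if_true, List.append_nil, List.reverse_reverse,
    List.length_reverse] at h0 h
  exact (h.seq ((RunLE.pop_data _ _ _ _ _).seq h0)).mono (by omega)

/-- A function on bit strings that is computed on trees in polynomial time is computed in
polynomial time by a Turing machine. -/
theorem polyTime_of_poly {α : Type} {code f : α → List Bool}
    (h : Poly (fun a => tr (code a)) (fun a => tr (f a))) : PolyTime code f := by
  have hb : PolyBound (fun a => (tr (code a)).size) fun a => (code a).length :=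
    (((PolyBound.self _).mul (.const 4 _)).add (.const 1 _)).mono fun a =>
      size_le_of_forall fun b _ => size_bool_le b
  have hf : PolyBound (fun a => (f a).length) fun a => (code a).length :=
    (h.polyBound.trans hb).mono fun a => (length_lt_size _).le
  obtain ⟨p, T, hT, hp⟩ := h
  obtain ⟨k, hk⟩ := (((PolyBound.const 13 _).mul (.self fun a => (code a).length)).add
    (.const 3 _)).add ((hT.trans hb).add (((PolyBound.const 12 _).mul hf).add (.const 3 _)))
  refine polyTime_of_run (.seq .input (.seq p .output)) k fun a => ?_
  have := (runLE_input (code a)).seq (.seq (S' := store (tr (f a)).code [] [] [])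
    (by simpa using hp a [] []) (runLE_output (f a)))
  obtain ⟨t, ht, hr⟩ := this
  exact ⟨t, ht.trans (hk a), hr⟩

/-! ### Polynomial-time operations on lists and numbers -/

namespace Poly

variable {ι : Type} {A B C : ι → BTree}

/-- A function of a bound variable is a family over the pairs of an index and a value of the
variable; its input is the pair of the trees of both. A value that does not depend on the bound
variable is computed from the first component. -/
theorem weaken {κ : ι → Type} {X : (Σ i, κ i) → BTree} (h : Poly A B) :
    Poly (fun p : Σ i, κ i => (A p.1).cons (X p)) (fun p => B p.1) :=
  (refl _).fst.trans (h.reindex Sigma.fst)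

/-- The bound variable. -/
theorem var {κ : ι → Type} {X : (Σ i, κ i) → BTree} :
    Poly (fun p : Σ i, κ i => (A p.1).cons (X p)) X :=
  (refl _).snd

variable {α β σ : ι → Type} [∀ i, ToTree (α i)] [∀ i, ToTree (β i)] [∀ i, ToTree (σ i)]

theorem prodMk {x : ∀ i, α i} {y : ∀ i, β i} (hx : Poly A fun i => tr (x i))
    (hy : Poly A fun i => tr (y i)) : Poly A fun i => tr (x i, y i) :=
  hx.pair hy

theorem prodFst {x : ∀ i, α i × β i} (hx : Poly A fun i => tr (x i)) :
    Poly A fun i => tr (x i).1 :=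
  Poly.fst (C := fun i => tr (x i).2) hx

theorem prodSnd {x : ∀ i, α i × β i} (hx : Poly A fun i => tr (x i)) :
    Poly A fun i => tr (x i).2 :=
  Poly.snd (B := fun i => tr (x i).1) hx

/-- The first component of the bound variable. -/
theorem varFst : Poly (fun p : Σ i, α i × β i => (A p.1).cons (tr p.2)) (fun p => tr p.2.1) :=
  (refl _).snd.fst

/-- The second component of the bound variable. -/
theorem varSnd : Poly (fun p : Σ i, α i × β i => (A p.1).cons (tr p.2)) (fun p => tr p.2.2) :=
  (refl _).snd.snd

theorem listNil : Poly A fun i => tr ([] : List (α i)) :=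
  nil

theorem listCons {x : ∀ i, α i} {l : ∀ i, List (α i)} (hx : Poly A fun i => tr (x i))
    (hl : Poly A fun i => tr (l i)) : Poly A fun i => tr (x i :: l i) :=
  hx.pair hl

theorem ite {c : ι → Bool} (hc : Poly A fun i => tr (c i)) (hB : Poly A B) (hC : Poly A C) :
    Poly A fun i => if c i then B i else C i := by
  refine hc.cases ((hC.reindex Subtype.val).congr fun i => ?_)
    ((hB.reindex Subtype.val).congr fun i => ?_)
  · have := i.2
    cases h : c i.1 <;> simp_all [tr]
  · have := i.2
    cases h : c i.1 <;> simp_all [tr]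

theorem listCases {l : ∀ i, List (α i)} {F : ∀ i, α i → List (α i) → BTree}
    (hl : Poly A fun i => tr (l i)) (hB : Poly A B)
    (hF : Poly (fun p : Σ i, α i × List (α i) => (A p.1).cons (tr p.2))
      (fun p => F p.1 p.2.1 p.2.2)) :
    Poly A fun i => match l i with
      | [] => B i
      | x :: t => F i x t := by
  refine hl.cases ((hB.reindex Subtype.val).congr fun i => ?_) ?_
  · rw [tr_eq_nil.1 i.2]
  · have hne (i : {i // tr (l i) ≠ .nil}) : l i ≠ [] := fun h => i.2 (tr_eq_nil.2 h)
    have h1 : Poly (fun i : {i // tr (l i) ≠ .nil} => A i)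
        (fun i => tr ((l i).head (hne i), (l i).tail)) := by
      refine (hl.reindex Subtype.val).congr fun i => ?_
      exact congrArg tr (List.cons_head_tail (hne i)).symm
    refine (((refl _).pair h1).trans (hF.reindex fun i : {i // tr (l i) ≠ .nil} =>
      ⟨i.1, (l i).head (hne i), (l i).tail⟩)).congr fun i => ?_
    have := List.cons_head_tail (hne i)
    dsimp only
    split
    · exact absurd ‹_› (hne i)
    · simp [*]

theorem optionCases {o : ∀ i, Option (α i)} {F : ∀ i, α i → BTree}
    (ho : Poly A fun i => tr (o i)) (hB : Poly A B)
    (hF : Poly (fun p : Σ i, α i => (A p.1).cons (tr p.2)) (fun p => F p.1 p.2)) :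
    Poly A fun i => match o i with
      | none => B i
      | some x => F i x := by
  have h : Poly A fun i => tr (o i).toList := ho
  refine (h.listCases (F := fun i x _ => F i x) hB ?_).congr fun i => ?_
  · exact ((refl _).fst.pair (refl _).snd.fst).trans
      (hF.reindex fun p : Σ i, α i × List (α i) => ⟨p.1, p.2.1⟩)
  · cases o i <;> rfl

/-- The left fold over a list, provided that the intermediate results are of polynomial size. -/
theorem foldl {l : ∀ i, List (α i)} {s : ∀ i, σ i} {f : ∀ i, σ i → α i → σ i}
    (hl : Poly A fun i => tr (l i)) (hs : Poly A fun i => tr (s i))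
    (hf : Poly (fun p : Σ i, σ i × α i => (A p.1).cons (tr p.2))
      (fun p => tr (f p.1 p.2.1 p.2.2)))
    (hb : PolyBound (fun p : ι × ℕ => (tr (((l p.1).take p.2).foldl (f p.1) (s p.1))).size)
      (fun p => (A p.1).size)) :
    Poly A fun i => tr ((l i).foldl (f i) (s i)) := by
  have h := iterate (A := A) (N := fun i => (l i).length) (U := fun i k => tr ((l i).drop k))
    (V := fun i k => (A i).cons (tr (((l i).take k).foldl (f i) (s i))))
    (fun i k hk h => by simp only [tr_eq_nil, List.drop_eq_nil_iff] at h; omega)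
    (fun i => by simp [tr_eq_nil]) (by simpa using hl.pair ((refl A).pair hs)) ?_ ?_ ?_
  · simpa using h.snd
  · let J := {j : ι × ℕ // j.2 < (l j.1).length}
    let X : J → BTree := fun j => (BTree.cons (tr ((l j.1.1)[j.1.2]'j.2))
      (tr ((l j.1.1).drop (j.1.2 + 1)))).cons
        ((A j.1.1).cons (tr (((l j.1.1).take j.1.2).foldl (f j.1.1) (s j.1.1))))
    have hX (j : J) : (tr ((l j.1.1).drop j.1.2)).cons
        ((A j.1.1).cons (tr (((l j.1.1).take j.1.2).foldl (f j.1.1) (s j.1.1)))) = X j := by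
      rw [List.drop_eq_getElem_cons j.2]
      rfl
    have h1 : Poly X X := refl X
    have h2 := h1.snd.fst.pair (h1.snd.snd.pair h1.fst.fst)
    have h3 := h2.trans (hf.reindex fun j : J =>
      ⟨j.1.1, ((l j.1.1).take j.1.2).foldl (f j.1.1) (s j.1.1), (l j.1.1)[j.1.2]'j.2⟩)
    rw [show (fun j : J => _) = X from funext hX]
    refine (h1.fst.snd.pair (h1.snd.fst.pair h3)).congr fun j => ?_
    rw [List.take_add_one, List.getElem?_eq_getElem j.2, Option.toList_some, List.foldl_append]
    rfl
  · exact hl.polyBound.mono fun i => (length_lt_size _).le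
  · have h1 := (hl.polyBound).reindex fun j : {j : ι × ℕ // j.2 < (l j.1).length} => j.1.1
    have h2 := hb.reindex fun j : {j : ι × ℕ // j.2 < (l j.1).length} => j.1
    refine ((h1.add ((PolyBound.self _).add h2)).add (.const 2 _)).mono fun j => ?_
    have := size_drop_le (l j.1.1) j.1.2
    simp only [size]
    omega

theorem listReverse {l : ∀ i, List (α i)} (hl : Poly A fun i => tr (l i)) :
    Poly A fun i => tr (l i).reverse := by
  have key {γ : Type} (l m : List γ) : l.foldl (fun t x => x :: t) m = l.reverse ++ m := by
    induction l generalizing m with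
    | nil => rfl
    | cons a l ih => simp [ih]
  refine (foldl (σ := fun i => List (α i)) (f := fun i t x => x :: t) (s := fun i => []) hl listNil
    (varSnd.listCons varFst) (hl.polyBound.reindex Prod.fst |>.mono fun p => ?_)).congr
    fun i => by simp [key]
  rw [key, List.append_nil, size_reverse]
  exact size_take_le _ _

/-- The right fold over a list, provided that the intermediate results are of polynomial size. -/
theorem foldr {l : ∀ i, List (α i)} {s : ∀ i, σ i} {f : ∀ i, α i → σ i → σ i}
    (hl : Poly A fun i => tr (l i)) (hs : Poly A fun i => tr (s i))
    (hf : Poly (fun p : Σ i, α i × σ i => (A p.1).cons (tr p.2))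
      (fun p => tr (f p.1 p.2.1 p.2.2)))
    (hb : PolyBound (fun p : ι × ℕ => (tr (((l p.1).drop p.2).foldr (f p.1) (s p.1))).size)
      (fun p => (A p.1).size)) :
    Poly A fun i => tr ((l i).foldr (f i) (s i)) := by
  refine (foldl (f := fun i t x => f i x t) hl.listReverse hs ?_ ?_).congr
    fun i => by rw [List.foldl_reverse]
  · exact ((refl _).fst.pair (varSnd.prodMk varFst)).trans
      (hf.reindex fun p : Σ i, σ i × α i => ⟨p.1, p.2.2, p.2.1⟩)
  · refine (hb.reindex fun p : ι × ℕ => (p.1, (l p.1).length - p.2)).mono fun p => ?_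
    rw [List.take_reverse, List.foldl_reverse]

theorem listAppend {l m : ∀ i, List (α i)} (hl : Poly A fun i => tr (l i))
    (hm : Poly A fun i => tr (m i)) : Poly A fun i => tr (l i ++ m i) := by
  refine (foldr (f := fun i x t => x :: t) hl hm var ?_).congr fun i => by simp
  refine ((hl.polyBound.add hm.polyBound).reindex Prod.fst).mono fun p => ?_
  have h1 := size_append ((l p.1).drop p.2) (m p.1)
  have h2 := size_drop_le (l p.1) p.2
  rw [List.foldr_cons_eq_append']
  omega

theorem listFlatMap {l : ∀ i, List (α i)} {f : ∀ i, α i → List (β i)}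
    (hl : Poly A fun i => tr (l i))
    (hf : Poly (fun p : Σ i, α i => (A p.1).cons (tr p.2)) (fun p => tr (f p.1 p.2))) :
    Poly A fun i => tr ((l i).flatMap (f i)) := by
  have key {γ δ : Type} (l : List γ) (f : γ → List δ) :
      l.foldr (fun x t => f x ++ t) [] = l.flatMap f := by
    induction l with
    | nil => rfl
    | cons a l ih => simp [ih]
  refine (foldr (σ := fun i => List (β i)) (f := fun i x t => f i x ++ t) (s := fun i => []) hl
    listNil (listAppend ?_ varSnd) ?_).congr fun i => by rw [key]
  · exact ((refl _).fst.pair varFst).trans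
      (hf.reindex fun p : Σ i, α i × List (β i) => ⟨p.1, p.2.1⟩)
  · obtain ⟨k, hk⟩ := hf.polyBound
    have h1 : PolyBound (fun i => (tr (l i)).size *
        (((A i).size + (tr (l i)).size + 2) ^ k + 1) + 1) (fun i => (A i).size) :=
      (hl.polyBound.mul ((((PolyBound.self _).add hl.polyBound).add (.const 2 _)).pow k |>.add
        (.const 1 _))).add (.const 1 _)
    refine (h1.reindex Prod.fst).mono fun p => ?_
    rw [key]
    have main : ∀ m : List (α p.1), (∀ x ∈ m, (tr x).size < (tr (l p.1)).size) →
        (tr (m.flatMap (f p.1))).size ≤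
          m.length * (((A p.1).size + (tr (l p.1)).size + 2) ^ k + 1) + 1 := by
      intro m
      induction m with
      | nil => intro _; simp [tr, listTree, size]
      | cons a m ih =>
        intro h
        have h1 := ih fun x hx => h x (List.mem_cons_of_mem _ hx)
        have h2 := size_append (f p.1 a) (m.flatMap (f p.1))
        have h3 := h a List.mem_cons_self
        have h4 : (tr (f p.1 a)).size ≤ ((A p.1).size + (tr a).size + 1 + 2) ^ k := hk ⟨p.1, a⟩
        have h5 : ((A p.1).size + (tr a).size + 1 + 2) ^ k ≤
            ((A p.1).size + (tr (l p.1)).size + 2) ^ k := Nat.pow_le_pow_left (by omega) k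
        rw [List.flatMap_cons, List.length_cons, Nat.succ_mul]
        omega
    refine (main _ fun x hx => size_lt_of_mem (List.mem_of_mem_drop hx)).trans ?_
    have := length_lt_size (l p.1)
    gcongr
    rw [List.length_drop]
    omega

theorem listMap {l : ∀ i, List (α i)} {f : ∀ i, α i → β i} (hl : Poly A fun i => tr (l i))
    (hf : Poly (fun p : Σ i, α i => (A p.1).cons (tr p.2)) (fun p => tr (f p.1 p.2))) :
    Poly A fun i => tr ((l i).map (f i)) :=
  (hl.listFlatMap (f := fun i x => [f i x])
    (hf.listCons (α := fun p : Σ i, α i => β p.1) listNil)).congr fun i => by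
      rw [List.map_eq_flatMap]

theorem listFilter {l : ∀ i, List (α i)} {f : ∀ i, α i → Bool} (hl : Poly A fun i => tr (l i))
    (hf : Poly (fun p : Σ i, α i => (A p.1).cons (tr p.2)) (fun p => tr (f p.1 p.2))) :
    Poly A fun i => tr ((l i).filter (f i)) := by
  refine (hl.listFlatMap (f := fun i x => if f i x then [x] else [])
    ((hf.ite (listCons (α := fun p : Σ i, α i => α p.1) var listNil)
      (listNil (α := fun p : Σ i, α i => α p.1))).congr fun p => ?_)).congr fun i => ?_
  · split <;> rfl
  · refine congrArg tr ?_
    induction l i with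
    | nil => rfl
    | cons a l ih => by_cases h : f i a <;> simp [h, ih]

theorem isEmpty {l : ∀ i, List (α i)} (hl : Poly A fun i => tr (l i)) :
    Poly A fun i => tr (l i).isEmpty :=
  (hl.listCases (F := fun _ _ _ => tr false) (const (tr true)) (const _)).congr fun i => by
    cases l i <;> rfl

theorem listAll {l : ∀ i, List (α i)} {f : ∀ i, α i → Bool} (hl : Poly A fun i => tr (l i))
    (hf : Poly (fun p : Σ i, α i => (A p.1).cons (tr p.2)) (fun p => tr (f p.1 p.2))) :
    Poly A fun i => tr ((l i).all (f i)) := by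
  have hn : Poly (fun p : Σ i, α i => (A p.1).cons (tr p.2)) (fun p => tr (!f p.1 p.2)) :=
    (hf.ite (const (tr false)) (const (tr true))).congr fun p => by cases f p.1 p.2 <;> rfl
  refine (hl.listFilter (f := fun i x => !f i x) hn).isEmpty.congr fun i => congrArg tr ?_
  induction l i with
  | nil => rfl
  | cons a l ih => by_cases h : f i a <;> simp_all

theorem listDrop {l : ∀ i, List (α i)} {n : ι → ℕ} (hl : Poly A fun i => tr (l i))
    (hn : Poly A fun i => tr (n i)) : Poly A fun i => tr ((l i).drop (n i)) := by
  have key {γ : Type} (l : List γ) (n : ℕ) :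
      (List.replicate n ()).foldl (fun t _ => t.tail) l = l.drop n := by
    induction n generalizing l with
    | zero => rfl
    | succ n ih => rw [List.replicate_succ, List.foldl_cons, ih, List.drop_tail, add_comm]
  have hn' : Poly A fun i => tr (List.replicate (n i) ()) := hn
  refine (foldl (f := fun i t _ => t.tail) hn' hl ?_ ?_).congr fun i => by rw [key]
  · refine ((varFst (β := fun _ => Unit)).listCases (B := fun _ => .nil) (F := fun _ _ t => tr t)
      nil (refl _).snd.snd).congr fun p => ?_
    rcases p with ⟨i, l, u⟩
    cases l <;> rfl
  · refine (hl.polyBound.reindex Prod.fst).mono fun p => ?_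
    rw [List.take_replicate, key]
    exact size_drop_le _ _

theorem listGet {l : ∀ i, List (α i)} {n : ι → ℕ} (hl : Poly A fun i => tr (l i))
    (hn : Poly A fun i => tr (n i)) (h : ∀ i, n i < (l i).length) :
    Poly A fun i => tr ((l i)[n i]'(h i)) :=
  ((hl.listDrop hn).congr fun i => by rw [List.drop_eq_getElem_cons (h i), tr_cons]).fst

theorem length {l : ∀ i, List (α i)} (hl : Poly A fun i => tr (l i)) :
    Poly A fun i => tr (l i).length :=
  (hl.listMap (β := fun _ => Unit) (f := fun _ _ => ()) nil).congr fun i => by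
    rw [List.map_const', tr_nat]

variable {m n : ι → ℕ}

theorem natLE (hm : Poly A fun i => tr (m i)) (hn : Poly A fun i => tr (n i)) :
    Poly A fun i => tr (decide (m i ≤ n i)) := by
  -- In unary, the truncated difference is a list from which `n i` members are dropped.
  refine (listDrop (α := fun _ => Unit) (l := fun i => List.replicate (m i) ())
    hm hn).isEmpty.congr fun i => ?_
  congr 1
  rw [Bool.eq_iff_iff]
  simp [Nat.sub_eq_zero_iff_le]

theorem and {b c : ι → Bool} (hb : Poly A fun i => tr (b i)) (hc : Poly A fun i => tr (c i)) :
    Poly A fun i => tr (b i && c i) :=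
  (hb.ite hc (const (tr false))).congr fun i => by cases b i <;> rfl

theorem or {b c : ι → Bool} (hb : Poly A fun i => tr (b i)) (hc : Poly A fun i => tr (c i)) :
    Poly A fun i => tr (b i || c i) :=
  (hb.ite (const (tr true)) hc).congr fun i => by cases b i <;> rfl

theorem not {b : ι → Bool} (hb : Poly A fun i => tr (b i)) :
    Poly A fun i => tr (!b i) :=
  (hb.ite (const (tr false)) (const (tr true))).congr fun i => by cases b i <;> rfl

theorem natEq (hm : Poly A fun i => tr (m i)) (hn : Poly A fun i => tr (n i)) :
    Poly A fun i => tr (decide (m i = n i)) :=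
  ((hm.natLE hn).and (hn.natLE hm)).congr fun i => by
    congr 1
    rw [Bool.eq_iff_iff]
    simp [le_antisymm_iff]

theorem finEq {k : ι → ℕ} {a b : ∀ i, Fin (k i)} (ha : Poly A fun i => tr (a i))
    (hb : Poly A fun i => tr (b i)) : Poly A fun i => tr (decide (a i = b i)) :=
  (natEq (m := fun i => a i) (n := fun i => b i) ha hb).congr fun i => by
    congr 1
    simp [Fin.ext_iff]

theorem range (hn : Poly A fun i => tr (n i)) : Poly A fun i => tr (List.range (n i)) := by
  have key (n : ℕ) : (List.replicate n ()).foldl (fun t _ => t.length :: t) ([] : List ℕ) =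
      (List.range n).reverse := by
    induction n with
    | zero => rfl
    | succ n ih => rw [List.replicate_succ', List.foldl_append, ih]; simp [List.range_succ]
  have hn' : Poly A fun i => tr (List.replicate (n i) ()) := hn
  have h : Poly A fun i => tr ((List.replicate (n i) ()).foldl (fun t _ => t.length :: t)
      ([] : List ℕ)) := by
    refine foldl (σ := fun _ => List ℕ) (f := fun i t _ => t.length :: t) hn' listNil ?_ ?_
    · have h := varFst (A := A) (α := fun _ => List ℕ) (β := fun _ => Unit)
      exact h.length.listCons h
    · have hb := hn.polyBound
      have hb2 := (((hb.mul (hb.add (.const 1 _))).add (.const 1 _)))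
      refine (hb2.reindex Prod.fst).mono fun p => ?_
      rw [List.take_replicate, key, size_reverse]
      refine (size_le_of_forall (b := (tr (n p.1)).size) fun a ha => ?_).trans ?_
      · rw [List.mem_range] at ha
        rw [size_nat, size_nat]
        omega
      · rw [List.length_range]
        gcongr
        rw [size_nat]
        omega
  exact h.listReverse.congr fun i => by rw [key, List.reverse_reverse]

theorem finRange (hn : Poly A fun i => tr (n i)) : Poly A fun i => tr (List.finRange (n i)) :=
  hn.range.congr fun i => by
    rw [← List.map_coe_finRange_eq_range]
    exact tr_map (fun a : Fin (n i) => (a : ℕ)) (fun _ => rfl) _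

end Poly

/-! ### The algorithm -/

section algorithm

variable {M α : Type} [Group M] [MulAction M α] [DecidableEq α]

/-- Given elements `s.1` that represent the cosets of the stabilizer of `a` and generators `s.2` of
that stabilizer, both for a group of exponent two, compute the same data for the group that is
generated in addition by `h`. -/
def extendTransversal (a : α) (s : List M × List M) (h : M) : List M × List M :=
  match s.1.filter (fun t => t • a = h • a) with
  | [] => (s.1 ++ s.1.map (h * ·), s.2)
  | t :: _ => (s.1, h * t :: s.2)

/-- Representatives of the cosets of the stabilizer of `a` in the group generated by `gens`, and
generators of that stabilizer. -/
def transversal (a : α) (gens : List M) : List M × List M :=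
  gens.foldl (extendTransversal a) ([1], [])

/-- Given the coset of `v` of the group generated by `gens`, compute in the same form the part of
those `g` that map `a` to an allowed point. -/
def refineAt (ok : α → α → Bool) (a : α) (v : M) (gens : List M) : Option (M × List M) :=
  match (transversal a gens).1.filter (fun t => ok a ((v * t) • a)) with
  | [] => none
  | t :: [] => some (v * t, (transversal a gens).2)
  | t :: t' :: _ => some (v * t, t * t' :: (transversal a gens).2)

/-- Refine a coset, if there is one. -/
def refineOption (ok : α → α → Bool) (o : Option (M × List M)) (a : α) : Option (M × List M) :=
  match o with
  | none => none
  | some s => refineAt ok a s.1 s.2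

/-- The coset of the elements of the group generated by `gens` that map each of the given points to
an allowed point, or `none` if there are no such elements. -/
def solutions (ok : α → α → Bool) (gens : List M) (points : List α) : Option (M × List M) :=
  points.foldl (refineOption ok) (some (1, gens))

/-- The subgroup generated by the members of a list. -/
def span (l : List M) : Subgroup M :=
  Subgroup.closure {x | x ∈ l}

theorem span_mono {l l' : List M} (h : ∀ x ∈ l, x ∈ l') : span l ≤ span l' :=
  Subgroup.closure_mono h

theorem mem_span {l : List M} {x : M} (h : x ∈ l) : x ∈ span l :=
  Subgroup.subset_closure h

theorem length_snd_transversal_le (a : α) (gens : List M) :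
    (transversal a gens).2.length ≤ gens.length := by
  induction gens using List.reverseRecOn with
  | nil => simp [transversal]
  | append_singleton l h ih =>
    rw [transversal, List.foldl_append]
    rw [transversal] at ih
    simp only [List.foldl_cons, List.foldl_nil, extendTransversal, List.length_append,
      List.length_singleton]
    split
    · exact ih.trans (Nat.le_succ _)
    · exact Nat.succ_le_succ ih

theorem length_refineAt_le {ok : α → α → Bool} {a : α} {v : M} {gens : List M}
    {s : M × List M} (hs : refineAt ok a v gens = some s) : s.2.length ≤ gens.length + 1 := by
  have h := length_snd_transversal_le a gens
  unfold refineAt at hs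
  split at hs
  · simp at hs
  · obtain rfl := Option.some.inj hs
    exact h.trans (Nat.le_succ _)
  · obtain rfl := Option.some.inj hs
    exact Nat.succ_le_succ h

theorem length_solutions_le {ok : α → α → Bool} {gens : List M} {points : List α}
    {s : M × List M} (hs : solutions ok gens points = some s) :
    s.2.length ≤ gens.length + points.length := by
  induction points using List.reverseRecOn generalizing s with
  | nil => obtain rfl := Option.some.inj hs; simp
  | append_singleton l a ih =>
    rw [solutions, List.foldl_append] at hs
    simp only [List.foldl_cons, List.foldl_nil] at hs
    unfold refineOption at hs
    split at hs
    · simp at hs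
    · have h1 := length_refineAt_le hs
      have h2 := ih ‹_›
      rw [List.length_append, List.length_singleton]
      omega

end algorithm

/-! ### Correctness of the algorithm -/

section correctness

variable {M α : Type} [CommGroup M] [MulAction M α]

theorem mul_mul_cancel_of_sq (hsq : ∀ x : M, x * x = 1) (x y : M) : x * (x * y) = y := by
  rw [← mul_assoc, hsq, one_mul]

theorem mem_span_cons (hsq : ∀ x : M, x * x = 1) {h x : M} {l : List M} :
    x ∈ span (h :: l) ↔ x ∈ span l ∨ h * x ∈ span l := by
  constructor
  · intro hx
    induction hx using Subgroup.closure_induction with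
    | mem y hy =>
      rcases List.mem_cons.1 hy with rfl | hy
      · exact .inr (by rw [hsq]; exact one_mem _)
      · exact .inl (mem_span hy)
    | one => exact .inl (one_mem _)
    | mul y z _ _ hy hz =>
      rcases hy with hy | hy <;> rcases hz with hz | hz
      · exact .inl (mul_mem hy hz)
      · exact .inr (by rw [mul_left_comm]; exact mul_mem hy hz)
      · exact .inr (by rw [← mul_assoc]; exact mul_mem hy hz)
      · refine .inl ?_
        have := mul_mem hy hz
        rwa [mul_mul_mul_comm, hsq, one_mul] at this
    | inv y _ hy => rwa [inv_eq_of_mul_eq_one_left (hsq y)]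
  · have hle : span l ≤ span (h :: l) := span_mono fun x hx => List.mem_cons_of_mem _ hx
    rintro (hx | hx)
    · exact hle hx
    · rw [← mul_mul_cancel_of_sq hsq h x]
      exact mul_mem (mem_span List.mem_cons_self) (hle hx)

/-- `s.1` represents the cosets of the stabilizer of `a` in the group generated by `l`, and `s.2`
generates this stabilizer. -/
structure IsTransversal (a : α) (l : List M) (s : List M × List M) : Prop where
  nodup : (s.1.map (· • a)).Nodup
  fst_mem : ∀ t ∈ s.1, t ∈ span l
  snd_mem : ∀ k ∈ s.2, k ∈ span l
  smul_eq : ∀ k ∈ s.2, k • a = a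
  exists_mem : ∀ x ∈ span l, ∃ t ∈ s.1, t * x ∈ span s.2

namespace IsTransversal

variable {a : α} {l : List M} {s : List M × List M}

theorem smul_eq_of_mem (hs : IsTransversal a l s) {k : M} (hk : k ∈ span s.2) : k • a = a := by
  have : span s.2 ≤ MulAction.stabilizer M a := by
    rw [span, Subgroup.closure_le]
    exact hs.smul_eq
  exact this hk

theorem span_snd_le (hs : IsTransversal a l s) : span s.2 ≤ span l := by
  rw [span, Subgroup.closure_le]
  exact hs.snd_mem

theorem smul_eq_smul (hsq : ∀ x : M, x * x = 1) (hs : IsTransversal a l s) {t x : M}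
    (h : t * x ∈ span s.2) : x • a = t • a := by
  have h1 := hs.smul_eq_of_mem h
  rw [← mul_mul_cancel_of_sq hsq t x, mul_smul, h1]

variable [DecidableEq α]

protected theorem extendTransversal (hsq : ∀ x : M, x * x = 1) (hs : IsTransversal a l s) (h : M) :
    IsTransversal a (h :: l) (extendTransversal a s h) := by
  have hle : span l ≤ span (h :: l) := span_mono fun x hx => List.mem_cons_of_mem _ hx
  have hh : h ∈ span (h :: l) := mem_span List.mem_cons_self
  unfold extendTransversal
  split
  · rename_i hf
    rw [List.filter_eq_nil_iff] at hf
    refine ⟨?_, ?_, fun k hk => hle (hs.snd_mem k hk), hs.smul_eq, ?_⟩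
    · rw [List.map_append, List.nodup_append]
      refine ⟨hs.nodup, ?_, ?_⟩
      · have := hs.nodup.map (MulAction.injective h)
        simpa [List.map_map, Function.comp_def, mul_smul] using this
      · intro b hb c hc hbc
        simp only [List.map_map, List.mem_map, Function.comp_apply] at hb hc
        obtain ⟨t, ht, rfl⟩ := hb
        obtain ⟨t', ht', rfl⟩ := hc
        -- The image of `a` under `h` would be its image under an element `t' * t` of the old group.
        obtain ⟨u, hu, hk⟩ := hs.exists_mem (t' * t) (mul_mem (hs.fst_mem _ ht') (hs.fst_mem _ ht))
        refine hf u hu ?_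
        rw [decide_eq_true_iff, ← hs.smul_eq_smul hsq hk, mul_smul, hbc, ← mul_smul, mul_left_comm,
          hsq, mul_one]
    · intro t ht
      rcases List.mem_append.1 ht with ht | ht
      · exact hle (hs.fst_mem t ht)
      · obtain ⟨u, hu, rfl⟩ := List.mem_map.1 ht
        exact mul_mem hh (hle (hs.fst_mem u hu))
    · intro x hx
      rcases (mem_span_cons hsq).1 hx with hx | hx
      · obtain ⟨t, ht, hk⟩ := hs.exists_mem x hx
        exact ⟨t, List.mem_append_left _ ht, hk⟩
      · obtain ⟨t, ht, hk⟩ := hs.exists_mem _ hx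
        exact ⟨h * t, List.mem_append_right _ (List.mem_map_of_mem ht), by
          rwa [mul_comm h t, mul_assoc]⟩
  · rename_i t _ hf
    have ht : t ∈ s.1.filter (fun t => t • a = h • a) := by rw [hf]; exact List.mem_cons_self
    rw [List.mem_filter, decide_eq_true_iff] at ht
    obtain ⟨ht, hta⟩ := ht
    have hle' : span s.2 ≤ span (h * t :: s.2) := span_mono fun x hx => List.mem_cons_of_mem _ hx
    refine ⟨hs.nodup, fun u hu => hle (hs.fst_mem u hu), ?_, ?_, ?_⟩
    · intro k hk
      rcases List.mem_cons.1 hk with rfl | hk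
      · exact mul_mem hh (hle (hs.fst_mem t ht))
      · exact hle (hs.snd_mem k hk)
    · intro k hk
      rcases List.mem_cons.1 hk with rfl | hk
      · rw [mul_comm, mul_smul, ← hta, ← mul_smul, hsq, one_smul]
      · exact hs.smul_eq k hk
    · intro x hx
      rcases (mem_span_cons hsq).1 hx with hx | hx
      · obtain ⟨u, hu, hk⟩ := hs.exists_mem x hx
        exact ⟨u, hu, hle' hk⟩
      · obtain ⟨u, hu, hk⟩ := hs.exists_mem (t * (h * x)) (mul_mem (hs.fst_mem t ht) hx)
        refine ⟨u, hu, (mem_span_cons hsq).2 (.inr ?_)⟩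
        rwa [mul_left_comm, mul_comm h t, mul_assoc]

theorem transversal (hsq : ∀ x : M, x * x = 1) (a : α) (gens : List M) :
    IsTransversal a gens (transversal a gens) := by
  induction gens using List.reverseRecOn with
  | nil =>
    refine ⟨by simp [GroupConstraint.transversal], ?_, ?_, ?_, ?_⟩
    · simp [GroupConstraint.transversal, one_mem]
    · simp [GroupConstraint.transversal]
    · simp [GroupConstraint.transversal]
    · intro x hx
      exact ⟨1, by simp [GroupConstraint.transversal], by
        simpa [GroupConstraint.transversal] using hx⟩
  | append_singleton l h ih =>
    have := ih.extendTransversal hsq h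
    have hspan : span (l ++ [h]) = span (h :: l) := by
      rw [span, span]
      congr 1
      ext x
      simp [or_comm]
    rw [GroupConstraint.transversal, List.foldl_append]
    exact ⟨this.nodup, by rw [hspan]; exact this.fst_mem, by rw [hspan]; exact this.snd_mem,
      this.smul_eq, by rw [hspan]; exact this.exists_mem⟩

end IsTransversal

variable [DecidableEq α]

theorem length_fst_transversal_le [Fintype α] (hsq : ∀ x : M, x * x = 1) (a : α) (gens : List M) :
    (transversal a gens).1.length ≤ Fintype.card α := by
  have := (IsTransversal.transversal hsq a gens).nodup.length_le_card
  rwa [List.length_map] at this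

/-- In the orbit of `a` there are at most two allowed images of `a`. -/
def AtMostTwo (M : Type) {α : Type} [Group M] [MulAction M α] (ok : α → α → Bool) : Prop :=
  ∀ (a : α) (x y z : M), ok a (x • a) → ok a (y • a) → ok a (z • a) →
    x • a = y • a ∨ x • a = z • a ∨ y • a = z • a

/-- The output of `refineAt` is the coset of the allowed elements. If two cosets of the stabilizer
are allowed, then their union is a coset of a larger group, because the exponent is two. -/
theorem refineAt_spec (hsq : ∀ x : M, x * x = 1) {ok : α → α → Bool} (hok : AtMostTwo M ok)
    (a : α) (v : M) (gens : List M) :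
    match refineAt ok a v gens with
    | none => ∀ g, v * g ∈ span gens → ¬ ok a (g • a)
    | some s => ∀ g, s.1 * g ∈ span s.2 ↔ v * g ∈ span gens ∧ ok a (g • a) := by
  have hs := IsTransversal.transversal hsq a gens
  set s := transversal a gens with hs_def
  -- The representatives of the allowed cosets.
  obtain ⟨T, hTs⟩ : ∃ T, T = s.1.filter (fun t => ok a ((v * t) • a)) := ⟨_, rfl⟩
  have hT {g t : M} (h : t * (v * g) ∈ span s.2) : ok a (g • a) ↔ ok a ((v * t) • a) := by
    have := hs.smul_eq_smul hsq h
    rw [mul_smul v t, ← this, ← mul_smul, mul_mul_cancel_of_sq hsq]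
  have hmem {g : M} (hg : v * g ∈ span gens) (hga : ok a (g • a)) :
      ∃ t ∈ T, t * (v * g) ∈ span s.2 := by
    obtain ⟨t, ht, hk⟩ := hs.exists_mem _ hg
    exact ⟨t, by rw [hTs]; exact List.mem_filter.2 ⟨ht, (hT hk).1 hga⟩, hk⟩
  have hmem' {g t : M} (ht : t ∈ T) (hk : t * (v * g) ∈ span s.2) :
      v * g ∈ span gens ∧ ok a (g • a) := by
    rw [hTs] at ht
    obtain ⟨ht, hta⟩ := List.mem_filter.1 ht
    refine ⟨?_, (hT hk).2 hta⟩
    have := mul_mem (hs.fst_mem t ht) (hs.span_snd_le hk)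
    rwa [mul_mul_cancel_of_sq hsq] at this
  unfold refineAt
  rw [← hs_def, ← hTs]
  have hnodup : (T.map (· • a)).Nodup := by
    rw [hTs]; exact hs.nodup.sublist (List.filter_sublist.map _)
  have hTok : ∀ t ∈ T, ok a ((v * t) • a) := by
    rw [hTs]; exact fun t ht => (List.mem_filter.1 ht).2
  clear hTs
  rcases T with _ | ⟨t, _ | ⟨t', T⟩⟩
  · intro g hg hga
    obtain ⟨t, ht, -⟩ := hmem hg hga
    simp at ht
  · intro g
    dsimp only
    rw [mul_comm v t, mul_assoc]
    refine ⟨hmem' List.mem_cons_self, fun ⟨hg, hga⟩ => ?_⟩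
    obtain ⟨u, hu, hk⟩ := hmem hg hga
    rwa [← List.mem_singleton.1 hu]
  · intro g
    dsimp only
    rw [mem_span_cons hsq, show t * t' * (v * t * g) = t' * (v * g) by
      rw [mul_comm v t, mul_assoc t v, mul_comm t t', mul_assoc t', mul_mul_cancel_of_sq hsq],
      mul_comm v t, mul_assoc]
    constructor
    · rintro (h | h)
      · exact hmem' List.mem_cons_self h
      · exact hmem' (List.mem_cons_of_mem _ List.mem_cons_self) h
    · rintro ⟨hg, hga⟩
      obtain ⟨u, hu, hk⟩ := hmem hg hga
      rcases List.mem_cons.1 hu with rfl | hu'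
      · exact .inl hk
      rcases List.mem_cons.1 hu' with rfl | hu'
      · exact .inr hk
      -- A third representative would yield a third allowed image of `a`.
      exfalso
      simp only [List.map_cons, List.nodup_cons, List.mem_cons, not_or] at hnodup
      obtain ⟨⟨h1, h2⟩, h3, -⟩ := hnodup
      have h4 := List.mem_map_of_mem (f := (· • a)) hu'
      have := hok a (v * t) (v * t') (v * u) (hTok _ List.mem_cons_self)
        (hTok _ (List.mem_cons_of_mem _ List.mem_cons_self)) (hTok _ hu)
      simp only [mul_smul, smul_left_cancel_iff] at this
      rcases this with h | h | h
      · exact h1 h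
      · exact h2 (by rw [h]; exact h4)
      · exact h3 (by rw [h]; exact h4)

theorem solutions_spec_comm (hsq : ∀ x : M, x * x = 1) {ok : α → α → Bool} (hok : AtMostTwo M ok)
    (gens : List M) (points : List α) :
    match solutions ok gens points with
    | none => ∀ g ∈ span gens, ¬ ∀ a ∈ points, ok a (g • a)
    | some s => ∀ g, s.1 * g ∈ span s.2 ↔ g ∈ span gens ∧ ∀ a ∈ points, ok a (g • a) := by
  induction points using List.reverseRecOn with
  | nil => intro g; simp
  | append_singleton l a ih =>
    rw [solutions, List.foldl_append]
    rw [solutions] at ih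
    simp only [List.foldl_cons, List.foldl_nil]
    cases ho : l.foldl (refineOption ok) (some (1, gens)) with
    | none =>
      rw [ho] at ih
      exact fun g hg h => ih g hg fun b hb => h b (List.mem_append_left _ hb)
    | some s =>
      rw [ho] at ih
      dsimp only at ih
      have h := refineAt_spec hsq hok a s.1 s.2
      rw [refineOption]
      cases hr : refineAt ok a s.1 s.2 with
      | none =>
        rw [hr] at h
        intro g hg hga
        exact h g ((ih g).2 ⟨hg, fun b hb => hga b (List.mem_append_left _ hb)⟩)
          (hga a (by simp))
      | some s' =>
        rw [hr] at h
        intro g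
        rw [h g, ih g]
        simp only [List.mem_append, List.mem_singleton, or_imp, forall_and, forall_eq, and_assoc]

end correctness

/-- A group of exponent two, with its commutativity. -/
abbrev commGroupOfSq {M : Type} [inst : Group M] (hsq : ∀ x : M, x * x = 1) : CommGroup M :=
  { inst with
    mul_comm := fun x y => by
      have h (x : M) : x⁻¹ = x := inv_eq_of_mul_eq_one_left (hsq x)
      rw [← h (x * y), mul_inv_rev, h, h] }

/-- The output of `solutions` is the coset of the solutions. -/
theorem solutions_spec {M α : Type} [inst : Group M] [MulAction M α] [DecidableEq α]
    (hsq : ∀ x : M, x * x = 1) {ok : α → α → Bool} (hok : AtMostTwo M ok)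
    (gens : List M) (points : List α) :
    match solutions ok gens points with
    | none => ∀ g ∈ span gens, ¬ ∀ a ∈ points, ok a (g • a)
    | some s => ∀ g, s.1 * g ∈ span s.2 ↔ g ∈ span gens ∧ ∀ a ∈ points, ok a (g • a) :=
  let _ : CommGroup M := commGroupOfSq hsq
  solutions_spec_comm hsq hok gens points

theorem length_fst_transversal_le_card {M α : Type} [inst : Group M] [MulAction M α]
    [DecidableEq α] [Fintype α] (hsq : ∀ x : M, x * x = 1) (a : α) (gens : List M) :
    (transversal a gens).1.length ≤ Fintype.card α :=
  let _ : CommGroup M := commGroupOfSq hsq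
  length_fst_transversal_le hsq a gens

/-! ### The algorithm runs in polynomial time -/

instance {n : ℕ} : ToTree (Perm (Fin n)) := ⟨fun g => tr (permTable g)⟩

instance {n : ℕ} (G : Subgroup (Perm (Fin n))) : ToTree G := ⟨fun g => tr (g : Perm (Fin n))⟩

/-- A set is encoded by its indicator function. -/
instance {n : ℕ} : ToTree (Finset (Fin n)) :=
  ⟨fun X => tr (List.ofFn fun b => if b ∈ X then 1 else 0 : List ℕ)⟩

theorem size_perm_le {n : ℕ} (g : Perm (Fin n)) : (tr g).size ≤ n * (2 * n + 2) + 1 := by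
  refine (size_le_of_forall (l := permTable g) (b := 2 * n + 1) fun x hx => ?_).trans ?_
  · obtain ⟨a, rfl⟩ := List.mem_ofFn.1 hx
    rw [size_nat]
    omega
  · rw [permTable, List.length_ofFn]

theorem size_group_le {n : ℕ} {G : Subgroup (Perm (Fin n))} (l : List G) {b : ℕ}
    (h : l.length ≤ b) : (tr l).size ≤ b * (n * (2 * n + 2) + 2) + 1 :=
  (size_le_of_forall fun g _ => size_perm_le g.1).trans (by gcongr)

namespace Poly

variable {ι : Type} {A : ι → BTree} {n : ι → ℕ} {G : ∀ i, Subgroup (Perm (Fin (n i)))}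

theorem permApply {g : ∀ i, Perm (Fin (n i))} {a : ∀ i, Fin (n i)}
    (hg : Poly A fun i => tr (g i)) (ha : Poly A fun i => tr (a i)) :
    Poly A fun i => tr (g i (a i)) :=
  (listGet (α := fun _ => ℕ) (l := fun i => permTable (g i)) (n := fun i => a i) hg ha
    fun i => by simp [permTable]).congr fun i => by
      simp only [permTable, List.getElem_ofFn]
      rfl

theorem permMul {g h : ∀ i, Perm (Fin (n i))} (hg : Poly A fun i => tr (g i))
    (hh : Poly A fun i => tr (h i)) : Poly A fun i => tr (g i * h i) := by
  have key {k : ℕ} (f : Perm (Fin k)) : tr f = tr (List.ofFn fun a => f a) := by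
    refine Eq.trans ?_ (tr_map (fun a : Fin k => (a : ℕ)) (fun _ => rfl) _)
    rw [List.map_ofFn]
    rfl
  have h1 : Poly A fun i => tr (List.ofFn fun a => h i a) := by simpa only [key] using hh
  refine (listMap (f := fun i a => g i a) h1 (permApply hg.weaken var)).congr fun i => ?_
  rw [key, List.map_ofFn]
  rfl

theorem groupMul {g h : ∀ i, G i} (hg : Poly A fun i => tr (g i))
    (hh : Poly A fun i => tr (h i)) : Poly A fun i => tr (g i * h i) :=
  permMul (g := fun i => (g i).1) (h := fun i => (h i).1) hg hh

theorem groupSMul {g : ∀ i, G i} {a : ∀ i, Fin (n i)} (hg : Poly A fun i => tr (g i))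
    (ha : Poly A fun i => tr (a i)) : Poly A fun i => tr (g i • a i) :=
  permApply (g := fun i => (g i).1) hg ha

theorem groupOne (hn : Poly A fun i => tr (n i)) : Poly A fun i => tr (1 : G i) :=
  hn.range.congr fun i => by
    rw [← List.map_coe_finRange_eq_range, ← List.ofFn_eq_map]
    rfl

theorem extendTransversal {a : ∀ i, Fin (n i)} {s : ∀ i, List (G i) × List (G i)} {h : ∀ i, G i}
    (ha : Poly A fun i => tr (a i)) (hs : Poly A fun i => tr (s i))
    (hh : Poly A fun i => tr (h i)) :
    Poly A fun i => tr (extendTransversal (a i) (s i) (h i)) := by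
  have h1 := listFilter (f := fun i t => decide (t • a i = h i • a i)) hs.prodFst
    (finEq (k := fun p : Σ i, G i => n p.1)
      (groupSMul (G := fun p : Σ i, G i => G p.1) var ha.weaken)
      (groupSMul (G := fun p : Σ i, G i => G p.1) hh.weaken ha.weaken))
  have h2 := hs.prodFst.listAppend (hs.prodFst.listMap (f := fun i t => h i * t)
    (groupMul (G := fun p : Σ i, G i => G p.1) hh.weaken var))
  refine (h1.listCases (F := fun i t _ => tr ((s i).1, h i * t :: (s i).2))
    (h2.prodMk hs.prodSnd) ?_).congr fun i => ?_
  · exact prodMk (α := fun p : Σ i, G i × List (G i) => List (G p.1)) hs.prodFst.weaken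
      (listCons (α := fun p : Σ i, G i × List (G i) => G p.1)
        (groupMul (G := fun p : Σ i, G i × List (G i) => G p.1) hh.weaken varFst)
        hs.prodSnd.weaken)
  · unfold GroupConstraint.extendTransversal
    rcases (s i).1.filter (fun t => t • a i = h i • a i) with _ | ⟨t, T⟩ <;> rfl

theorem transversal (hsq : ∀ i, ∀ x : G i, x * x = 1) {a : ∀ i, Fin (n i)}
    {gens : ∀ i, List (G i)} (hn : Poly A fun i => tr (n i)) (ha : Poly A fun i => tr (a i))
    (hg : Poly A fun i => tr (gens i)) :
    Poly A fun i => tr (transversal (a i) (gens i)) := by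
  refine foldl (σ := fun i => List (G i) × List (G i))
    (f := fun i => GroupConstraint.extendTransversal (a i)) hg
    (prodMk ((groupOne hn).listCons listNil) listNil) ?_ ?_
  · exact extendTransversal (G := fun p : Σ i, (List (G i) × List (G i)) × G i => G p.1)
      ha.weaken varFst varSnd
  · have hbn : PolyBound n fun i => (A i).size :=
      hn.polyBound.mono fun i => by rw [size_nat]; omega
    have hbg : PolyBound (fun i => (gens i).length) fun i => (A i).size :=
      hg.polyBound.mono fun i => (length_lt_size _).le
    have hbp : PolyBound (fun i => n i * (2 * n i + 2) + 2) fun i => (A i).size :=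
      (hbn.mul (((PolyBound.const 2 _).mul hbn).add (.const 2 _))).add (.const 2 _)
    refine (((((hbn.mul hbp).add (.const 1 _)).add ((hbg.mul hbp).add (.const 1 _))).add
      (.const 1 _)).reindex Prod.fst).mono fun p => ?_
    have h1 := length_fst_transversal_le_card (hsq p.1) (a p.1) ((gens p.1).take p.2)
    have h2 := (length_snd_transversal_le (a p.1) ((gens p.1).take p.2)).trans
      (List.length_take_le' _ _)
    rw [Fintype.card_fin] at h1
    exact Nat.succ_le_succ (add_le_add (size_group_le _ h1) (size_group_le _ h2))

theorem refineAt (hsq : ∀ i, ∀ x : G i, x * x = 1) {ok : ∀ i, Fin (n i) → Fin (n i) → Bool}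
    (hok : Poly (fun p : Σ i, Fin (n i) × Fin (n i) => (A p.1).cons (tr p.2))
      fun p => tr (ok p.1 p.2.1 p.2.2))
    {a : ∀ i, Fin (n i)} {v : ∀ i, G i} {gens : ∀ i, List (G i)}
    (hn : Poly A fun i => tr (n i)) (ha : Poly A fun i => tr (a i))
    (hv : Poly A fun i => tr (v i)) (hg : Poly A fun i => tr (gens i)) :
    Poly A fun i => tr (refineAt (ok i) (a i) (v i) (gens i)) := by
  have hs := transversal hsq hn ha hg
  have h1 := listFilter (f := fun i t => ok i (a i) ((v i * t) • a i)) hs.prodFst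
    (((refl _).fst.pair (ha.weaken.pair
      (groupSMul (G := fun p : Σ i, G i => G p.1)
        (groupMul (G := fun p : Σ i, G i => G p.1) hv.weaken var) ha.weaken))).trans
      (hok.reindex fun p : Σ i, G i => ⟨p.1, a p.1, (v p.1 * p.2) • a p.1⟩))
  refine (h1.listCases (B := fun _ => .nil) (F := fun i t l => match l with
    | [] => tr (some (v i * t, (GroupConstraint.transversal (a i) (gens i)).2))
    | t' :: _ => tr (some (v i * t, t * t' :: (GroupConstraint.transversal (a i) (gens i)).2)))
    nil ?_).congr fun i => ?_
  · let κ := Σ i, G i × List (G i)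
    have h2 : Poly (fun p : κ => (A p.1).cons (tr p.2)) (fun p => tr (v p.1 * p.2.1)) :=
      groupMul (G := fun p : κ => G p.1) hv.weaken varFst
    refine (listCases (A := fun p : κ => (A p.1).cons (tr p.2)) (α := fun p : κ => G p.1)
      (l := fun p => p.2.2)
      (B := fun p => tr (some (v p.1 * p.2.1, (GroupConstraint.transversal (a p.1) (gens p.1)).2)))
      (F := fun p t' _ => tr (some (v p.1 * p.2.1,
        p.2.1 * t' :: (GroupConstraint.transversal (a p.1) (gens p.1)).2))) varSnd ?_ ?_).congr
          fun p => ?_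
    · exact pair (h2.pair hs.prodSnd.weaken) nil
    · exact pair (pair h2.weaken (pair
        (groupMul (G := fun q : Σ p : κ, G p.1 × List (G p.1) => G q.1.1)
          (refl _).fst.snd.fst (refl _).snd.fst)
        ((refl _).fst.fst.trans (hs.prodSnd.reindex
          fun q : Σ p : κ, G p.1 × List (G p.1) => q.1.1)))) nil
    · rcases p with ⟨i, t, _ | ⟨t', T⟩⟩ <;> rfl
  · unfold GroupConstraint.refineAt
    rcases (GroupConstraint.transversal (a i) (gens i)).1.filter
      (fun t => ok i (a i) ((v i * t) • a i)) with _ | ⟨t, _ | ⟨t', T⟩⟩ <;> rfl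

theorem solutions (hsq : ∀ i, ∀ x : G i, x * x = 1) {ok : ∀ i, Fin (n i) → Fin (n i) → Bool}
    (hok : Poly (fun p : Σ i, Fin (n i) × Fin (n i) => (A p.1).cons (tr p.2))
      fun p => tr (ok p.1 p.2.1 p.2.2))
    {gens : ∀ i, List (G i)} (hn : Poly A fun i => tr (n i))
    (hg : Poly A fun i => tr (gens i)) :
    Poly A fun i => tr (solutions (ok i) (gens i) (List.finRange (n i))) := by
  refine foldl (σ := fun i => Option (G i × List (G i))) (f := fun i => refineOption (ok i))
    hn.finRange (s := fun i => some (1, gens i)) ?_ ?_ ?_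
  · exact pair (pair (groupOne hn) hg) nil
  · let κ := Σ i, Option (G i × List (G i)) × Fin (n i)
    let κ' := Σ p : κ, G p.1 × List (G p.1)
    refine ((varFst (A := A)).optionCases (α := fun p : κ => G p.1 × List (G p.1))
      (B := fun _ => .nil) (F := fun p s => tr (GroupConstraint.refineAt (ok p.1) p.2.2 s.1 s.2))
      nil ?_).congr fun p => ?_
    · refine refineAt (G := fun q : κ' => G q.1.1) (ok := fun q => ok q.1.1)
        (a := fun q => q.1.2.2) (v := fun q => q.2.1) (gens := fun q => q.2.2)
        (fun q => hsq q.1.1) ?_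
        ((refl _).fst.fst.trans (hn.reindex fun q : κ' => q.1.1)) (refl _).fst.snd.snd
        (refl _).snd.fst (refl _).snd.snd
      exact ((refl _).fst.fst.fst.pair (refl _).snd).trans
        (hok.reindex fun q : Σ q : κ', Fin (n q.1.1) × Fin (n q.1.1) => ⟨q.1.1.1, q.2⟩)
    · rcases p with ⟨i, _ | s, a⟩ <;> rfl
  · have hbn : PolyBound n fun i => (A i).size :=
      hn.polyBound.mono fun i => by rw [size_nat]; omega
    have hbg : PolyBound (fun i => (gens i).length) fun i => (A i).size :=
      hg.polyBound.mono fun i => (length_lt_size _).le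
    have hbp : PolyBound (fun i => n i * (2 * n i + 2) + 2) fun i => (A i).size :=
      (hbn.mul (((PolyBound.const 2 _).mul hbn).add (.const 2 _))).add (.const 2 _)
    refine (((hbp.add ((hbg.add hbn).mul hbp)).add (.const 4 _)).reindex Prod.fst).mono
      fun p => ?_
    change (tr (GroupConstraint.solutions (ok p.1) (gens p.1)
      ((List.finRange (n p.1)).take p.2))).size ≤ _
    cases hs : GroupConstraint.solutions (ok p.1) (gens p.1)
      ((List.finRange (n p.1)).take p.2) with
    | none => exact le_add_left (show 1 ≤ 4 by decide)
    | some s =>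
      have h1 := length_solutions_le hs
      have h2 : ((List.finRange (n p.1)).take p.2).length ≤ n p.1 := by simp
      have h3 := size_perm_le s.1.1
      have h4 := size_group_le s.2 (h1.trans (Nat.add_le_add_left h2 _))
      have h5 : (tr (some s)).size = ((tr s.1.1).size + (tr s.2).size + 1) + 1 + 1 := rfl
      rw [h5]
      omega

end Poly

/-! ### Reading instances and writing answers -/

/-- Prepend a bit to the unary code of a list of numbers. -/
def addBit (b : Bool) (l : List ℕ) : List ℕ :=
  if b then
    match l with
    | [] => []
    | x :: t => (x + 1) :: t
  else 0 :: l

theorem foldr_addBit_natsCode (l : List ℕ) : (natsCode l).foldr addBit [] = l := by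
  induction l with
  | nil => rfl
  | cons i l ih =>
    have h : natsCode (i :: l) = List.replicate i true ++ (false :: natsCode l) := by
      simp [natsCode]
    rw [h]
    induction i with
    | zero => simp [addBit, ih]
    | succ i ihi =>
      rw [List.replicate_succ, List.cons_append, List.foldr_cons, ihi (by simp [natsCode])]
      rfl

theorem size_foldr_addBit_le (l : List Bool) :
    (tr (l.foldr addBit [])).size ≤ 2 * l.length + 1 := by
  induction l with
  | nil => simp [tr, listTree, size]
  | cons b l ih =>
    rw [List.foldr_cons, List.length_cons]
    cases b
    · have : (tr (0 :: l.foldr addBit [])).size = 1 + (tr (l.foldr addBit [])).size + 1 := rfl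
      simp only [addBit, Bool.false_eq_true, if_false]
      omega
    · simp only [addBit, if_true]
      cases h : l.foldr addBit [] with
      | nil => rw [h] at ih; dsimp only; omega
      | cons x t =>
        rw [h, size_cons, size_nat] at ih
        rw [size_cons, size_nat]
        omega

theorem size_map_le {α : Type} (t : α → List ℕ) (l : List α) :
    (tr (l.map t)).size ≤ (tr (l.flatMap t)).size + 2 * l.length := by
  induction l with
  | nil => exact le_rfl
  | cons a l ih =>
    have := size_append (t a) (l.flatMap t)
    rw [List.map_cons, size_cons, List.flatMap_cons, List.length_cons]
    omega

namespace Poly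

variable {ι : Type} {A : ι → BTree}

theorem natsDecode {l : ι → List ℕ} (h : Poly A fun i => tr (natsCode (l i))) :
    Poly A fun i => tr (l i) := by
  refine (foldr (σ := fun _ => List ℕ) (f := fun _ => addBit) (s := fun _ => []) h listNil ?_
    ?_).congr fun i => by rw [foldr_addBit_natsCode]
  · let κ := Σ _ : ι, Bool × List ℕ
    have h1 : Poly (fun p : κ => (A p.1).cons (tr p.2))
        (fun p => match p.2.2 with
          | [] => .nil
          | x :: t => tr ((x + 1) :: t)) := by
      refine (listCases (A := fun p : κ => (A p.1).cons (tr p.2)) (α := fun _ => ℕ)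
        (l := fun p => p.2.2)
        (F := fun _ x t => tr ((x + 1) :: t)) varSnd nil
        (pair (pair nil (refl _).snd.fst) (refl _).snd.snd)).congr fun p => ?_
      rcases p with ⟨i, _, _ | ⟨x, t⟩⟩ <;> rfl
    have h2 : Poly (fun p : κ => (A p.1).cons (tr p.2)) (fun p => tr (0 :: p.2.2)) :=
      pair nil varSnd
    refine (ite (c := fun p : κ => p.2.1) varFst h1 h2).congr fun p => ?_
    rcases p with ⟨i, _ | _, _ | ⟨x, t⟩⟩ <;> rfl
  · refine ((((PolyBound.const 2 _).mul h.polyBound).add (.const 1 _)).reindex Prod.fst).mono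
      fun p => (size_foldr_addBit_le _).trans ?_
    have := length_lt_size (natsCode (l p.1))
    rw [List.length_drop]
    omega

theorem natsEncode {l : ι → List ℕ} (h : Poly A fun i => tr (l i)) :
    Poly A fun i => tr (natsCode (l i)) := by
  refine listFlatMap (β := fun _ => Bool)
    (f := fun _ (x : ℕ) => List.replicate x true ++ [false]) h ?_
  refine listAppend (α := fun _ => Bool) ?_ (const (tr [false]))
  refine (listMap (A := fun p : Σ _ : ι, ℕ => (A p.1).cons (tr p.2)) (α := fun _ => Unit)
    (l := fun p => List.replicate p.2 ()) (f := fun _ _ => true) var (const (tr true))).congr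
      fun p => by rw [List.map_replicate]

variable {α : ι → Type}

theorem listTake [∀ i, ToTree (α i)] {l : ∀ i, List (α i)} {n : ι → ℕ}
    (hl : Poly A fun i => tr (l i)) (hn : Poly A fun i => tr (n i)) (h : ∀ i, n i ≤ (l i).length) :
    Poly A fun i => tr ((l i).take (n i)) := by
  refine (hn.finRange.listMap (α := fun i => Fin (n i))
    (f := fun i x => (l i)[(x : ℕ)]'(x.2.trans_le (h i)))
    (listGet (α := fun p : Σ i, Fin (n i) => α p.1) (n := fun p => p.2) hl.weaken var
      fun p => p.2.2.trans_le (h p.1))).congr fun i => congrArg tr ?_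
  apply List.ext_getElem
  · simp [h i]
  · intro k h1 h2
    simp

/-- Cut the concatenation of lists of the same length `w i` into these lists. -/
theorem chunks {l : ∀ i, List (α i)} {t : ∀ i, α i → List ℕ} {w : ι → ℕ} {r : ι → List ℕ}
    (hw : ∀ i x, (t i x).length = w i) (hn : Poly A fun i => tr (w i))
    (hm : Poly A fun i => tr (l i).length)
    (h : Poly A fun i => tr ((l i).flatMap (t i) ++ r i)) :
    Poly A fun i => (tr ((l i).map (t i))).cons (tr (r i)) := by
  -- After `k` rounds: the first `k` chunks, in reverse order, and the part not yet read.
  let V : ι → ℕ → BTree := fun i k => (tr (w i)).cons ((tr (((l i).take k).map (t i)).reverse).cons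
    (tr (((l i).drop k).flatMap (t i) ++ r i)))
  have hb : PolyBound (fun i => (l i).length) fun i => (A i).size :=
    hm.polyBound.mono fun i => by rw [size_nat]; omega
  have hV : Poly A fun i => V i (l i).length := by
    refine iterate (U := fun i k => tr ((l i).length - k)) (V := V) (fun i k hk h => ?_)
      (fun i => ?_) ?_ ?_ hb ?_
    · rw [tr_nat, tr_eq_nil, List.replicate_eq_nil_iff] at h
      omega
    · rw [Nat.sub_self]
      rfl
    · exact hm.pair (hn.pair (nil.pair h))
    · let J := {j : ι × ℕ // j.2 < (l j.1).length}
      let X : J → BTree := fun j => (BTree.cons .nil (tr ((l j.1.1).length - (j.1.2 + 1)))).cons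
        ((tr (w j.1.1)).cons ((tr (((l j.1.1).take j.1.2).map (t j.1.1)).reverse).cons
          (tr (t j.1.1 ((l j.1.1)[j.1.2]'j.2) ++
            (((l j.1.1).drop (j.1.2 + 1)).flatMap (t j.1.1) ++ r j.1.1)))))
      have hX (j : J) : (tr ((l j.1.1).length - j.1.2)).cons (V j.1.1 j.1.2) = X j := by
        have h1 : (l j.1.1).length - j.1.2 = ((l j.1.1).length - (j.1.2 + 1)) + 1 := by
          have := j.2
          omega
        simp only [V]
        rw [h1, List.drop_eq_getElem_cons j.2, List.flatMap_cons, List.append_assoc]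
        rfl
      have h1 : Poly X X := refl X
      have h2 := h1.snd.fst
      have h3 := h1.snd.snd.snd
      have h4 := listTake (α := fun _ => ℕ) h3 h2 fun j => by simp [hw]
      have h5 := listDrop (α := fun _ => ℕ) h3 h2
      rw [show (fun j : J => _) = X from funext hX]
      refine (h1.fst.snd.pair (h2.pair ((pair h4 h1.snd.snd.fst).pair h5))).congr fun j => ?_
      have h6 : w j.1.1 = (t j.1.1 ((l j.1.1)[j.1.2]'j.2)).length := (hw _ _).symm
      simp only [V]
      rw [h6, List.take_left, List.drop_left, ← h6, List.take_add_one,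
        List.getElem?_eq_getElem j.2, Option.toList_some, List.map_append, List.reverse_append]
      rfl
    · refine (((hm.polyBound.add hn.polyBound).add ((h.polyBound.add h.polyBound).add
        (((PolyBound.const 2 _).mul hb).add (.const 3 _)))).reindex
        fun j : {j : ι × ℕ // j.2 < (l j.1).length} => j.1.1).mono fun j => ?_
      have h1 := size_map_le (t j.1.1) (l j.1.1)
      have h2 := size_append ((l j.1.1).flatMap (t j.1.1)) (r j.1.1)
      have h3 := size_take_le ((l j.1.1).map (t j.1.1)) j.1.2
      have h4 := size_append (((l j.1.1).take j.1.2).flatMap (t j.1.1))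
        (((l j.1.1).drop j.1.2).flatMap (t j.1.1))
      have h5 := size_append (((l j.1.1).drop j.1.2).flatMap (t j.1.1)) (r j.1.1)
      have h6 := size_pos (tr (((l j.1.1).take j.1.2).flatMap (t j.1.1)))
      have h7 := size_pos (tr (r j.1.1))
      rw [← List.flatMap_append, List.take_append_drop] at h4
      rw [← List.map_take] at h3
      simp only [V, size, size_nat, size_reverse]
      omega
  exact (pair hV.snd.fst.listReverse hV.snd.snd).congr fun i => by simp

theorem finsetMem {n : ι → ℕ} {X : ∀ i, Finset (Fin (n i))} {a : ∀ i, Fin (n i)}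
    (hX : Poly A fun i => tr (X i)) (ha : Poly A fun i => tr (a i)) :
    Poly A fun i => tr (decide (a i ∈ X i)) :=
  (listGet (α := fun _ => ℕ) (l := fun i => List.ofFn fun b => if b ∈ X i then 1 else 0)
    (n := fun i => a i) hX ha fun i => by simp).congr fun i => by
      rw [List.getElem_ofFn]
      by_cases h : a i ∈ X i <;> simp only [Fin.eta, h, if_true, if_false] <;> rfl

end Poly

namespace Instance

/-- The generators of the group of an instance, as elements of this group. -/
def generators (I : Instance) : List I.group :=
  I.gens.attach.map fun g => ⟨g.1, Subgroup.subset_closure g.2⟩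

theorem tr_generators (I : Instance) : tr I.generators = tr I.gens := by
  refine (tr_map (fun g : I.group => (g : Perm (Fin I.n))) (fun _ => rfl) _).symm.trans ?_
  rw [generators, List.map_map]
  exact congrArg tr I.gens.attach_map_subtype_val

/-- All the conjuncts on `a` allow the image `b`. -/
def allows (I : Instance) (a b : Fin I.n) : Bool :=
  I.constraint.all fun c => !decide (c.1 = a) || decide (b ∈ c.2)

/-- The coset of the solutions. -/
def solutionCoset (I : Instance) : Option (I.group × List I.group) :=
  solutions I.allows I.generators (List.finRange I.n)

/-- The solution found by the algorithm. -/
def answer (I : Instance) : Option (Perm (Fin I.n)) :=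
  I.solutionCoset.map fun s => s.1

end Instance

/-- An instance can be read in polynomial time. -/
theorem poly_instance {ι : Type} (I : ι → Instance) :
    Poly (fun i => tr (I i).code)
      (fun i => (tr (I i).n).cons ((tr (I i).gens).cons (tr (I i).constraint))) := by
  have h0 : Poly (fun i => tr (I i).code) (fun i => tr ((I i).n :: (I i).gens.length ::
      ((I i).gens.flatMap permTable ++
        ((I i).constraint.length :: (I i).constraint.flatMap atomTable)))) :=
    Poly.natsDecode (Poly.refl _)
  have hn := h0.fst
  have h1 := Poly.chunks (α := fun i => Perm (Fin (I i).n)) (t := fun i => permTable)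
    (fun i x => by simp [permTable]) hn h0.snd.fst h0.snd.snd
  have h2 : Poly (fun i => tr (I i).code) (fun i => tr ((I i).constraint.length ::
    ((I i).constraint.flatMap atomTable ++ []))) := h1.snd.congr fun i => by simp
  have h3 := Poly.chunks (α := fun i => Fin (I i).n × Finset (Fin (I i).n))
    (w := fun i => (I i).n + 1) (t := fun i => atomTable) (fun i x => by simp [atomTable])
    (Poly.pair Poly.nil hn) h2.fst h2.snd
  refine (hn.pair (h1.fst.pair h3.fst)).congr fun i => ?_
  rw [tr_map permTable (fun _ => rfl), tr_map atomTable (fun _ => rfl)]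

theorem poly_solutionCoset {ι : Type} (I : ι → Instance)
    (hsq : ∀ i, ∀ x : (I i).group, x * x = 1) :
    Poly (fun i => tr (I i).code) (fun i => tr (I i).solutionCoset) := by
  have h := poly_instance I
  refine Poly.solutions (G := fun i => (I i).group) hsq ?_ h.fst
    (h.snd.fst.congr fun i => (I i).tr_generators.symm)
  let κ := Σ i, Fin (I i).n × Fin (I i).n
  let κ' := Σ p : κ, Fin (I p.1).n × Finset (Fin (I p.1).n)
  refine Poly.listAll (α := fun p : κ => Fin (I p.1).n × Finset (Fin (I p.1).n))
    (f := fun p c => !decide (c.1 = p.2.1) || decide (p.2.2 ∈ c.2)) h.snd.snd.weaken ?_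
  exact (Poly.finEq (k := fun q : κ' => (I q.1.1).n) (Poly.refl _).snd.fst
    (Poly.refl _).fst.snd.fst).not.or (Poly.finsetMem (n := fun q : κ' => (I q.1.1).n)
      (Poly.refl _).snd.snd (Poly.refl _).fst.snd.snd)

theorem poly_isSome {ι : Type} (I : ι → Instance)
    (hsq : ∀ i, ∀ x : (I i).group, x * x = 1) :
    Poly (fun i => tr (I i).code) (fun i => tr [(I i).answer.isSome]) :=
  ((poly_solutionCoset I hsq).optionCases (F := fun _ _ => tr [true])
    (Poly.const (tr [false])) (Poly.const _)).congr fun i => by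
      unfold Instance.answer
      cases (I i).solutionCoset <;> rfl

theorem poly_answerCode {ι : Type} (I : ι → Instance)
    (hsq : ∀ i, ∀ x : (I i).group, x * x = 1) :
    Poly (fun i => tr (I i).code) (fun i => tr (answerCode (I i).answer)) := by
  refine ((poly_solutionCoset I hsq).optionCases
    (F := fun i s => tr (true :: natsCode (permTable s.1.1))) (Poly.const (tr [false]))
    (Poly.pair (Poly.const (tr true)) (Poly.natsEncode ?_))).congr fun i => ?_
  · exact (Poly.refl fun p : Σ i, (I i).group × List (I i).group =>
      (tr (I p.1).code).cons (tr p.2)).snd.fst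
  · unfold Instance.answer
    cases (I i).solutionCoset <;> rfl

/-! ### Elementary Abelian groups of exponent two and 2-constraints -/

namespace Instance

variable {I : Instance}

theorem mul_self_eq_one (h : IsElementaryAbelian 2 I.group) {g : Perm (Fin I.n)}
    (hg : g ∈ I.group) : g * g = 1 := by
  by_cases h1 : g = 1
  · rw [h1, one_mul]
  · rw [← sq, ← h.2 g hg h1, pow_orderOf_eq_one]

theorem allows_iff {a b : Fin I.n} : I.allows a b ↔ ∀ c ∈ I.constraint, c.1 = a → b ∈ c.2 := by
  simp [allows, or_iff_not_imp_left]

/-- A 2-constraint does not allow three distinct images of a point. -/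
theorem eq_of_mem_normalForm (h : I.IsKConstraint 2) {a b c d : Fin I.n}
    (hb : b ∈ I.normalForm a) (hc : c ∈ I.normalForm a) (hd : d ∈ I.normalForm a) :
    b = c ∨ b = d ∨ c = d := by
  by_contra! hne
  have := (Set.two_lt_ncard_iff (Set.toFinite (I.normalForm a))).2
    ⟨b, c, d, hb, hc, hd, hne.1, hne.2.1, hne.2.2⟩
  exact (h a).not_gt this

theorem atMostTwo_allows (h : I.IsKConstraint 2) : AtMostTwo I.group I.allows :=
  fun _ x y z hx hy hz => eq_of_mem_normalForm h ⟨⟨x, rfl⟩, allows_iff.1 hx⟩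
    ⟨⟨y, rfl⟩, allows_iff.1 hy⟩ ⟨⟨z, rfl⟩, allows_iff.1 hz⟩

theorem span_generators (I : Instance) : span I.generators = ⊤ := by
  have : {x | x ∈ I.generators} = ((↑) ⁻¹' {g | g ∈ I.gens} : Set I.group) := by
    ext x
    simp only [generators, Set.mem_ofPred_eq, List.mem_map, List.mem_attach, true_and,
      Subtype.exists, Set.mem_preimage]
    constructor
    · rintro ⟨g, hg, rfl⟩
      exact hg
    · exact fun hx => ⟨x, hx, rfl⟩
  rw [span, this]
  exact Subgroup.closure_closure_coe_preimage

theorem isSolution_iff (g : I.group) :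
    I.IsSolution g ↔ ∀ a ∈ List.finRange I.n, I.allows a (g • a) := by
  simp only [IsSolution, g.2, true_and, List.mem_finRange, forall_const, allows_iff]
  exact ⟨fun h a c hc hca => hca ▸ h c hc, fun h c hc => h c.1 c hc rfl⟩

theorem isSolution_of_answer (h : IsElementaryAbelian 2 I.group) (hk : I.IsKConstraint 2)
    {g : Perm (Fin I.n)} (hg : I.answer = some g) : I.IsSolution g := by
  have hs := solutions_spec (fun x : I.group => Subtype.ext (mul_self_eq_one h x.2))
    (atMostTwo_allows hk) I.generators (List.finRange I.n)
  rw [answer, solutionCoset, Option.map_eq_some_iff] at hg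
  obtain ⟨s, hs', rfl⟩ := hg
  rw [hs'] at hs
  have h1 : s.1 * s.1 ∈ span s.2 := by
    rw [show s.1 * s.1 = 1 from Subtype.ext (mul_self_eq_one h s.1.2)]
    exact one_mem _
  exact (isSolution_iff _).2 ((hs s.1).1 h1).2

theorem not_isSolution_of_answer (h : IsElementaryAbelian 2 I.group) (hk : I.IsKConstraint 2)
    (hn : I.answer = none) (g : Perm (Fin I.n)) : ¬ I.IsSolution g := by
  have hs := solutions_spec (fun x : I.group => Subtype.ext (mul_self_eq_one h x.2))
    (atMostTwo_allows hk) I.generators (List.finRange I.n)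
  rw [answer, solutionCoset, Option.map_eq_none_iff] at hn
  rw [hn] at hs
  intro hg
  exact hs ⟨g, hg.1⟩ (by rw [span_generators]; trivial) ((isSolution_iff ⟨g, hg.1⟩).1 hg)

end Instance

/-! ### Linearity of 2-constraints -/

namespace Instance

variable {I : Instance}

theorem smul_mem_orbit {O : Set (Fin I.n)} (hO : O ∈ I.orbits) {u : Perm (Fin I.n)}
    (hu : u ∈ I.group) (a : Fin I.n) : u a ∈ O ↔ a ∈ O := by
  obtain ⟨b, rfl⟩ := hO
  change (⟨u, hu⟩ : I.group) • a ∈ MulAction.orbit I.group b ↔ a ∈ MulAction.orbit I.group b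
  rw [← MulAction.orbit_eq_iff, ← MulAction.orbit_eq_iff, MulAction.orbit_smul]

theorem constituent_mul_self (hG : IsElementaryAbelian 2 I.group) {O : Set (Fin I.n)}
    (hO : O ∈ I.orbits) {w : Perm (Fin I.n)} (hw : w ∈ I.constituent O) : w * w = 1 := by
  obtain ⟨u, hu, h1, h2⟩ := hw
  have hsq := mul_self_eq_one hG hu
  ext a
  by_cases ha : a ∈ O
  · have := congrArg (fun x : Perm (Fin I.n) => x a) hsq
    simp only [Perm.mul_apply, Perm.one_apply] at this ⊢
    rw [h1 a ha, h1 _ ((smul_mem_orbit hO hu a).2 ha), this]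
  · simp only [Perm.mul_apply, Perm.one_apply]
    rw [h2 a ha, h2 a ha]

theorem constituent_apply_mem_iff {O O' : Set (Fin I.n)}
    (hO' : O' ∈ I.orbits) {w : Perm (Fin I.n)} (hw : w ∈ I.constituent O) (a : Fin I.n) :
    w a ∈ O' ↔ a ∈ O' := by
  obtain ⟨u, hu, h1, h2⟩ := hw
  by_cases ha : a ∈ O
  · rw [h1 a ha, smul_mem_orbit hO' hu]
  · rw [h2 a ha]

theorem constituent_mul_comm (hG : IsElementaryAbelian 2 I.group) {O O' : Set (Fin I.n)}
    (hO : O ∈ I.orbits) (hO' : O' ∈ I.orbits) {w w' : Perm (Fin I.n)}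
    (hw : w ∈ I.constituent O) (hw' : w' ∈ I.constituent O') : w * w' = w' * w := by
  have k1 := constituent_apply_mem_iff hO' hw
  have k2 := constituent_apply_mem_iff hO hw'
  obtain ⟨u, hu, h1, h2⟩ := hw
  obtain ⟨u', hu', h1', h2'⟩ := hw'
  have hc := hG.1 u hu u' hu'
  ext a
  have hca := congrArg (fun x : Perm (Fin I.n) => x a) hc
  simp only [Perm.mul_apply] at hca ⊢
  congr 1
  by_cases ha : a ∈ O <;> by_cases ha' : a ∈ O'
  · rw [h1 _ ((k2 a).2 ha), h1' a ha', h1' _ ((k1 a).2 ha'), h1 a ha, hca]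
  · rw [h2' a ha', h2' _ (fun h => ha' ((k1 a).1 h))]
  · rw [h2 a ha, h2 _ (fun h => ha ((k2 a).1 h))]
  · rw [h2' a ha', h2 a ha, h2' a ha']

theorem constituent_subset_superSpace {O : Set (Fin I.n)} (hO : O ∈ I.orbits) :
    I.constituent O ⊆ I.superSpace :=
  fun _ hw => Subgroup.subset_closure (Set.mem_biUnion hO hw)

theorem superSpace_mul_comm (hG : IsElementaryAbelian 2 I.group) {x y : Perm (Fin I.n)}
    (hx : x ∈ I.superSpace) (hy : y ∈ I.superSpace) : x * y = y * x := by
  have : I.superSpace ≤ Subgroup.centralizer (I.superSpace : Set (Perm (Fin I.n))) := by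
    rw [superSpace, Subgroup.centralizer_closure, Subgroup.closure_le]
    intro w hw
    rw [SetLike.mem_coe, Subgroup.mem_centralizer_iff]
    intro w' hw'
    simp only [Set.mem_iUnion] at hw hw'
    obtain ⟨O, hO, hw⟩ := hw
    obtain ⟨O', hO', hw'⟩ := hw'
    exact constituent_mul_comm hG hO' hO hw' hw
  exact (Subgroup.mem_centralizer_iff.1 (this hx) y hy).symm

theorem superSpace_mul_self (hG : IsElementaryAbelian 2 I.group) {x : Perm (Fin I.n)}
    (hx : x ∈ I.superSpace) : x * x = 1 := by
  refine Subgroup.closure_induction (p := fun x _ => x * x = 1) ?_ (one_mul 1) ?_ ?_ hx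
  · intro w hw
    simp only [Set.mem_iUnion] at hw
    obtain ⟨O, hO, hw⟩ := hw
    exact constituent_mul_self hG hO hw
  · intro x y hx' hy' hx hy
    rw [mul_assoc, ← mul_assoc y, superSpace_mul_comm hG hy' hx', mul_assoc x y, hy, mul_one, hx]
  · intro x _ hx
    rw [← mul_inv_rev, hx, inv_one]

/-- The constituents are regular, so an allowed vector is determined by the image of one point.
Hence among three allowed vectors two coincide. -/
theorem allowed_mul_mul_mem (hG : IsElementaryAbelian 2 I.group) (hk : I.IsKConstraint 2)
    {O : Set (Fin I.n)} (hO : O ∈ I.orbits) {x y z : Perm (Fin I.n)} (hx : x ∈ I.allowed O)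
    (hy : y ∈ I.allowed O) (hz : z ∈ I.allowed O) : x * y * z ∈ I.allowed O := by
  have hsub {x : Perm (Fin I.n)} (hx : x ∈ I.allowed O) : x ∈ I.superSpace :=
    constituent_subset_superSpace hO hx.1
  obtain ⟨b, rfl⟩ := id hO
  have hb : b ∈ MulAction.orbit I.group b := MulAction.mem_orbit_self b
  have hinj {x y : Perm (Fin I.n)} (hx : x ∈ I.allowed (MulAction.orbit I.group b))
      (hy : y ∈ I.allowed (MulAction.orbit I.group b)) (h : x b = y b) : x = y := by
    obtain ⟨⟨u, hu, h1, h2⟩, -⟩ := hx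
    obtain ⟨⟨u', hu', h1', h2'⟩, -⟩ := hy
    rw [h1 b hb, h1' b hb] at h
    ext a
    congr 1
    by_cases ha : a ∈ MulAction.orbit I.group b
    · rw [h1 a ha, h1' a ha]
      obtain ⟨g, rfl⟩ := ha
      have e1 := congrArg (fun x : Perm (Fin I.n) => x b) (hG.1 u hu g g.2)
      have e2 := congrArg (fun x : Perm (Fin I.n) => x b) (hG.1 u' hu' g g.2)
      simp only [Perm.mul_apply] at e1 e2
      change u ((g : Perm (Fin I.n)) b) = u' ((g : Perm (Fin I.n)) b)
      rw [e1, e2, h]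
    · rw [h2 a ha, h2' a ha]
  have h3 := eq_of_mem_normalForm hk (hx.2 b hb) (hy.2 b hb) (hz.2 b hb)
  rcases h3 with h | h | h
  · rw [hinj hx hy h, superSpace_mul_self hG (hsub hy), one_mul]
    exact hz
  · rw [hinj hx hz h, superSpace_mul_comm hG (hsub hz) (hsub hy), mul_assoc,
      superSpace_mul_self hG (hsub hz), mul_one]
    exact hy
  · rw [hinj hy hz h, mul_assoc, superSpace_mul_self hG (hsub hz), mul_one]
    exact hx

theorem list_prod_map_mem {γ M : Type} [Group M] {F : Subgroup M} {x : γ → M} {l : List γ}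
    (hx : ∀ c ∈ l, x c ∈ F) : (l.map x).prod ∈ F :=
  Subgroup.list_prod_mem _ fun w hw => by
    obtain ⟨c, hc, rfl⟩ := List.mem_map.1 hw
    exact hx c hc

theorem prod_map_mul_mul {γ M : Type} [Group M] {F : Subgroup M}
    (hF : ∀ x ∈ F, ∀ y ∈ F, x * y = y * x) {x y z : γ → M} {l : List γ}
    (hx : ∀ c ∈ l, x c ∈ F) (hy : ∀ c ∈ l, y c ∈ F) (hz : ∀ c ∈ l, z c ∈ F) :
    (l.map fun c => x c * y c * z c).prod =
      (l.map x).prod * (l.map y).prod * (l.map z).prod := by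
  induction l with
  | nil => simp
  | cons c l ih =>
    simp only [List.mem_cons, forall_eq_or_imp] at hx hy hz
    have hX := list_prod_map_mem hx.2
    have hY := list_prod_map_mem hy.2
    simp only [List.map_cons, List.prod_cons]
    rw [ih hx.2 hy.2 hz.2,
      Commute.mul_mul_mul_comm (hF _ hz.1 _ (mul_mem hX hY) : Commute _ _) (x c * y c),
      Commute.mul_mul_mul_comm (hF _ hy.1 _ hX : Commute _ _) (x c)]

theorem allowedSum_subset_superSpace (I : Instance) : I.allowedSum ⊆ I.superSpace := by
  rintro w ⟨v, hv, rfl⟩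
  refine list_prod_map_mem fun O hO => ?_
  have hO : O ∈ I.orbits := by simpa using hO
  exact constituent_subset_superSpace hO (hv O hO).1

theorem mul_mul_mem_allowedSum (hG : IsElementaryAbelian 2 I.group) (hk : I.IsKConstraint 2)
    {x y z : Perm (Fin I.n)} (hx : x ∈ I.allowedSum) (hy : y ∈ I.allowedSum)
    (hz : z ∈ I.allowedSum) : x * y * z ∈ I.allowedSum := by
  obtain ⟨x, hx, rfl⟩ := hx
  obtain ⟨y, hy, rfl⟩ := hy
  obtain ⟨z, hz, rfl⟩ := hz
  refine ⟨fun O => x O * y O * z O,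
    fun O hO => allowed_mul_mul_mem hG hk hO (hx O hO) (hy O hO) (hz O hO), ?_⟩
  have hmem {v : Set (Fin I.n) → Perm (Fin I.n)} (hv : ∀ O ∈ I.orbits, v O ∈ I.allowed O) :
      ∀ O ∈ (Set.toFinite I.orbits).toFinset.toList, v O ∈ I.superSpace := by
    intro O hO
    have hO : O ∈ I.orbits := by simpa using hO
    exact constituent_subset_superSpace hO (hv O hO).1
  exact (prod_map_mul_mul (fun x hx y hy => superSpace_mul_comm hG hx hy) (hmem hx) (hmem hy)
    (hmem hz)).symm

/-- A nonempty set of vectors over the field with two elements that is closed under the sum of three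
vectors is a linear variety. -/
theorem isLinear (hG : IsElementaryAbelian 2 I.group) (hk : I.IsKConstraint 2) : I.IsLinear := by
  rcases I.allowedSum.eq_empty_or_nonempty with h | ⟨v, hv⟩
  · exact .inl h
  have hsub := I.allowedSum_subset_superSpace
  have hvF := hsub hv
  have hvv := superSpace_mul_self hG hvF
  have hF {h : Perm (Fin I.n)} (hh : v * h ∈ I.allowedSum) : h ∈ I.superSpace := by
    have := mul_mem hvF (hsub hh)
    rwa [← mul_assoc, hvv, one_mul] at this
  refine .inr ⟨v, hvF,
    { carrier := {h | v * h ∈ I.allowedSum}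
      one_mem' := by simpa using hv
      mul_mem' := fun {a b} ha hb => ?_
      inv_mem' := fun {a} ha => ?_ }, fun h hh => hF hh, ?_⟩
  · have := mul_mul_mem_allowedSum hG hk ha hv hb
    rwa [mul_assoc (v * a), ← mul_assoc v v, hvv, one_mul, mul_assoc] at this
  · have h1 : a⁻¹ = a := inv_eq_of_mul_eq_one_left (superSpace_mul_self hG (hF ha))
    rwa [Set.mem_ofPred_eq, h1]
  · ext u
    constructor
    · intro hu
      have h1 : v * (v * u) = u := by rw [← mul_assoc, hvv, one_mul]
      exact ⟨v * u, show v * (v * u) ∈ I.allowedSum by rwa [h1], h1.symm⟩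
    · rintro ⟨h, hh, rfl⟩
      exact hh

end Instance

/-! ### The decision problem and the search problem -/

theorem RestrictedInstance.mul_self_eq_one (I : RestrictedInstance 2 2) (x : I.1.group) :
    x * x = 1 :=
  Subtype.ext (Instance.mul_self_eq_one I.2.1 x.2)

theorem decisionPolyTime_two_two : DecisionPolyTime 2 2 := by
  refine ⟨fun I => I.1.answer.isSome, fun I => ?_,
    polyTime_of_poly (poly_isSome (ι := RestrictedInstance 2 2) (fun I => I.1)
      RestrictedInstance.mul_self_eq_one)⟩
  change I.1.answer.isSome = true ↔ _
  constructor
  · intro h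
    obtain ⟨g, hg⟩ := Option.isSome_iff_exists.1 h
    exact ⟨g, Instance.isSolution_of_answer I.2.1 I.2.2 hg⟩
  · rintro ⟨g, hg⟩
    by_contra h
    exact Instance.not_isSolution_of_answer I.2.1 I.2.2 (Option.not_isSome_iff_eq_none.1 h) g hg

theorem searchPolyTime_two_two : SearchPolyTime 2 2 :=
  ⟨fun I => I.1.answer, fun I _ hg => Instance.isSolution_of_answer I.2.1 I.2.2 hg,
    fun I hI ⟨g, hg⟩ => Instance.not_isSolution_of_answer I.2.1 I.2.2 hI g hg,
    polyTime_of_poly (poly_answerCode (ι := RestrictedInstance 2 2) (fun I => I.1)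
      RestrictedInstance.mul_self_eq_one)⟩

end GroupConstraint

theorem mainTheorem2 :
    GroupConstraint.DecisionPolyTime 2 2 ∧ GroupConstraint.SearchPolyTime 2 2 ∧
      ∀ I : GroupConstraint.RestrictedInstance 2 2, I.1.IsLinear := by
  exact ⟨GroupConstraint.decisionPolyTime_two_two, GroupConstraint.searchPolyTime_two_two,
    fun I => I.1.isLinear I.2.1 I.2.2⟩
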